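/- Let $d>2$ be an integer, let $\varepsilon,\tilde\varepsilon>0$, and put $v_\varepsilon^2=\varepsilon^2$ and $v_{\varepsilon,\tilde\varepsilon}^2=\dfrac{1}{1/\varepsilon^2+1/\tilde\varepsilon^2}$. For $\theta\in\mathbb R^d$ let $P_\theta=\bigotimes_{i=1}^d\mathcal N(\theta_i,\varepsilon^2)$ be the law of the observation $X$ and $Q_\theta=\bigotimes_{i=1}^d\mathcal N(\theta_i,\tilde\varepsilon^2)$ the law of the future observation $Y$. For a (possibly improper) prior $\Pi$ on $\mathbb R^d$, the Bayesian predictive distribution $Q_\Pi(\cdot\,;x)$ is the average of $Q_\vartheta$ over the posterior distribution of $\vartheta$ given $X=x$, that is, over the probability measure proportional to $p_\vartheta(x)\,\Pi(d\vartheta)$, where $p_\vartheta$ is the density of $P_\vartheta$. The Kullback--Leibler risk of a predictive distribution $\widehat Q$ at $\theta$ is $$R_d(\theta,\widehat Q)=\int \mathrm{KL}\big(Q_\theta\,\big\|\,\widehat Q(\cdot\,;x)\big)\,P_\theta(dx)\in[0,\infty],$$ where $\mathrm{KL}(Q\|Q')=\int\log\frac{dQ}{dQ'}\,dQ$ if $Q\ll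 Q'$ and $\mathrm{KL}(Q\|Q')=\infty$ otherwise. Let $h(\theta)=\|\theta\|^{2-d}$ (Euclidean norm) be the Lebesgue density of Stein's prior, and let $Q_h$ be its Bayesian predictive distribution. For $\tau^2\ge 0$ let $Q_{G_\tau}$ be the Bayesian predictive distribution of the prior $\bigotimes_{i=1}^d\mathcal N(0,\tau^2)$ (the point mass at $0$ if $\tau^2=0$). Then for every $\theta\in\mathbb R^d$, $$R_d(\theta,Q_h)\;\le\;\log\left(\frac{v_\varepsilon^2}{v_{\varepsilon,\tilde\varepsilon}^2}\right)+\frac d2\log\left(\frac{1+(\|\theta\|^2/d)/v_{\varepsilon,\tilde\varepsilon}^2}{1+(\|\theta\|^2/d)/v_\varepsilon^2}\right),$$ and the second term on the right is the oracle risk among these Gaussian-prior predictive distributions: $$\frac d2\log\left(\frac{1+(\|\theta\|^2/d)/v_{\varepsilon,\tilde\varepsilon}^2}{1+(\|\theta\|^2/d)/v_\varepsilon^2}\right)=\min_{\tau^2\ge 0}R_d(\theta,Q_{G_\tau}).$$ That is, the risk of $Q_h$ is at most a constant independent of $d$ and $\theta$ plus the oracle risk. -/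

import Mathlib

open MeasureTheory ProbabilityTheory
open scoped ENNReal NNReal

namespace SteinPrediction

noncomputable section

/-- The product normal law `⊗ᵢ N(θᵢ, v)` on `ℝ^d` with common variance `v`
(the Dirac mass at `θ` when `v = 0`). -/
def normalLaw {d : ℕ} (θ : EuclideanSpace ℝ (Fin d)) (v : ℝ≥0) :
    Measure (EuclideanSpace ℝ (Fin d)) :=
  (Measure.pi fun i => gaussianReal (θ i) v).map (WithLp.toLp 2)

/-- The family `θ ↦ ⊗ᵢ N(θᵢ, v)` is measurable, so that it can be averaged over `θ`. -/
theorem measurable_normalLaw {d : ℕ} (v : ℝ≥0) :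
    Measurable fun θ : EuclideanSpace ℝ (Fin d) => normalLaw θ v := by
  have h : ∀ θ : EuclideanSpace ℝ (Fin d), normalLaw θ v
      = (normalLaw (0 : EuclideanSpace ℝ (Fin d)) v).map (fun x => θ + x) := by
    intro θ
    have hpi : (Measure.pi fun i => gaussianReal (θ i) v)
        = (Measure.pi fun _ : Fin d => gaussianReal 0 v).map (fun x i => θ i + x i) := by
      rw [Measure.pi_map_pi (fun i => by fun_prop)]
      congr 1
      funext i
      rw [gaussianReal_map_const_add, zero_add]
    unfold normalLaw
    rw [hpi, Measure.map_map (by fun_prop) (by fun_prop),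
      Measure.map_map (by fun_prop) (by fun_prop)]
    rfl
  have : IsProbabilityMeasure (normalLaw (0 : EuclideanSpace ℝ (Fin d)) v) := by
    unfold normalLaw
    exact Measure.isProbabilityMeasure_map (by fun_prop)
  refine Measure.measurable_of_measurable_coe _ fun s hs => ?_
  have hm : Measurable fun p : EuclideanSpace ℝ (Fin d) × EuclideanSpace ℝ (Fin d) =>
      p.1 + p.2 := measurable_fst.add measurable_snd
  have := measurable_measure_prodMk_left
    (ν := normalLaw (0 : EuclideanSpace ℝ (Fin d)) v) (hm hs)
  convert this using 2 with θ
  rw [h θ, Measure.map_apply (by fun_prop) hs]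
  rfl

/-- The Lebesgue density of `⊗ᵢ N(θᵢ, v)` at the point `x`, for `v ≠ 0`. -/
def normalDensity {d : ℕ} (θ : EuclideanSpace ℝ (Fin d)) (v : ℝ≥0)
    (x : EuclideanSpace ℝ (Fin d)) : ℝ≥0∞ :=
  ∏ i, gaussianPDF (θ i) v (x i)

/-- The formal marginal density at `x` of an observation `X ∣ θ ∼ ⊗ᵢ N(θᵢ, v)` under the
(possibly improper) prior `prior` on `θ`. -/
def marginalDensity {d : ℕ} (prior : Measure (EuclideanSpace ℝ (Fin d))) (v : ℝ≥0)
    (x : EuclideanSpace ℝ (Fin d)) : ℝ≥0∞ :=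
  ∫⁻ θ, normalDensity θ v x ∂prior

/-- The (formal) posterior distribution of `θ` given `X = x`, where `X ∣ θ ∼ ⊗ᵢ N(θᵢ, v)` and
`prior` is a possibly improper prior. -/
def posteriorLaw {d : ℕ} (prior : Measure (EuclideanSpace ℝ (Fin d))) (v : ℝ≥0)
    (x : EuclideanSpace ℝ (Fin d)) : Measure (EuclideanSpace ℝ (Fin d)) :=
  (marginalDensity prior v x)⁻¹ • prior.withDensity fun θ => normalDensity θ v x

/-- The Bayesian predictive distribution of `Y ∣ θ ∼ ⊗ᵢ N(θᵢ, w)` given `X = x`, where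
`X ∣ θ ∼ ⊗ᵢ N(θᵢ, v)`: the average of `⊗ᵢ N(θᵢ, w)` over the posterior of `θ`. -/
def bayesPredictive {d : ℕ} (prior : Measure (EuclideanSpace ℝ (Fin d))) (v w : ℝ≥0)
    (x : EuclideanSpace ℝ (Fin d)) : Measure (EuclideanSpace ℝ (Fin d)) :=
  (posteriorLaw prior v x).bind fun θ => normalLaw θ w

/-- The Kullback–Leibler risk at `θ` of a predictive distribution `Q` (a measure for each value
of the observation): the mean over `X ∼ ⊗ᵢ N(θᵢ, v)` of the Kullback–Leibler divergence of
the true law `⊗ᵢ N(θᵢ, w)` of `Y` from `Q X`. -/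
def klRisk {d : ℕ} (v w : ℝ≥0) (θ : EuclideanSpace ℝ (Fin d))
    (Q : EuclideanSpace ℝ (Fin d) → Measure (EuclideanSpace ℝ (Fin d))) : ℝ≥0∞ :=
  ∫⁻ x, InformationTheory.klDiv (normalLaw θ w) (Q x) ∂(normalLaw θ v)

/-- Stein's prior on `ℝ^d`: the measure with Lebesgue density `‖θ‖ ^ (2 - d)`. -/
def steinPrior (d : ℕ) : Measure (EuclideanSpace ℝ (Fin d)) :=
  volume.withDensity fun θ => ENNReal.ofReal (‖θ‖ ^ (2 - (d : ℝ)))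

/-- The prior `⊗ᵢ N(0, t)` with variance `t ≥ 0` in every coordinate. -/
def gaussianPrior (d : ℕ) (t : ℝ≥0) : Measure (EuclideanSpace ℝ (Fin d)) :=
  normalLaw 0 t

/-- The variance `ε²` as a nonnegative real. -/
def noiseVar (ε : ℝ) : ℝ≥0 := ⟨ε ^ 2, sq_nonneg ε⟩

/-- `v²_ε = ε²`. -/
def vSq (ε : ℝ) : ℝ := ε ^ 2

/-- `v²_{ε,δ} = 1 / (1/ε² + 1/δ²)`. -/
def vSqJoint (ε δ : ℝ) : ℝ := 1 / (1 / ε ^ 2 + 1 / δ ^ 2)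

end

end SteinPrediction

/-!
The risk of a Bayesian predictive distribution at `θ` depends on the prior only through the marginal
densities `M_s` of an observation with variance `s`, at `s = v` (the variance of `X`) and at
`s = u = v w / (v + w)` (the variance of the precision-weighted mean of `X` and `Y`): it equals
`(d / 2) log (v / u) + E log M_v(X) - E log M_u(Z)` with `X ∼ N(θ, v)` and `Z ∼ N(θ, u)`
(`klRisk_bayesPredictive`).

For the prior `N(0, t)` the marginal is `N(0, s + t)`, the risk is elementary, and it is minimal at
`t = ‖θ‖² / d` (`isLeast_klRisk_gaussianPrior`).

Stein's prior is a mixture of centred Gaussians, by the Gamma integral for `‖θ‖ ^ (2 - d)`. With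
`α = d / 2 - 1` this gives `M_s(z) = c s ^ (-α) F(‖z‖² / s)` for
`F(x) = ∫₀¹ p ^ (α - 1) exp (-p x / 2) dp` (`steinProfile`,
`marginalDensity_steinPrior`). With `ψ = -log F`, whose derivative is `steinRate`, and
`H(τ) = E ψ(‖τ θ + G‖²)`, `G` standard normal (`meanNegLogProfile`), the risk is
`log (v / u) + H(1 / √u) - H(1 / √v)`, and the asserted bound says that
`H(τ) - (d / 2) log (d + τ² ‖θ‖²)` is nonincreasing for `τ > 0` (`meanNegLogProfile_sub_le`).
Writing `η = τ θ`, `l = ‖η‖²` and `Z ∼ N(η, 1)`, this amounts to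
`E ψ'(‖Z‖²) ⟨Z, η⟩ ≤ (d / 2) l / (d + l)`.

An integration by parts in `F` shows `x ψ'(x) ≤ α`. Although `⟨Z, η⟩` changes sign, the pointwise
bound `ψ'(x) ≤ α / x` may be used under the expectation, since replacing `z` by `-z` shows that
`E ⟨Z, η⟩ g(Z) ≥ 0` for every even `g ≥ 0` (`integral_inner_mul_nonneg`). It remains to bound
`B = E ⟨Z, η⟩ / ‖Z‖²`. With `A = E 1 / ‖Z‖²`, Stein's identity gives `B = 1 - (d - 2) A`, a
reflection of the noise gives `B ≤ l A`, and so `B ≤ l / (d - 2 + l)` (`integral_inner_div_le`, where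
`‖z‖²` is replaced by `‖z‖² + κ` to avoid the singularity). Finally
`α l / (d - 2 + l) ≤ (d / 2) l / (d + l)`.
-/

namespace SteinPrediction

noncomputable section

/-! ### The normal law: density, characteristic function, moments -/

/-- The Lebesgue density at `z` of the centred normal law with covariance `s • 1` on `ℝ^d`. -/
def gaussianKernel {d : ℕ} (s : ℝ) (z : EuclideanSpace ℝ (Fin d)) : ℝ :=
  (√(2 * Real.pi * s))⁻¹ ^ d * Real.exp (-‖z‖ ^ 2 / (2 * s))

lemma gaussianKernel_pos {d : ℕ} {s : ℝ} (hs : 0 < s) (z : EuclideanSpace ℝ (Fin d)) :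
    0 < gaussianKernel s z := by
  unfold gaussianKernel
  have := Real.pi_pos
  positivity

lemma continuous_gaussianKernel {d : ℕ} (s : ℝ) :
    Continuous (gaussianKernel s : EuclideanSpace ℝ (Fin d) → ℝ) := by
  unfold gaussianKernel
  fun_prop

lemma log_gaussianKernel {d : ℕ} {s : ℝ} (hs : 0 < s) (z : EuclideanSpace ℝ (Fin d)) :
    Real.log (gaussianKernel s z)
      = -((d : ℝ) / 2 * Real.log (2 * Real.pi * s)) - ‖z‖ ^ 2 / (2 * s) := by
  have := Real.pi_pos
  unfold gaussianKernel
  rw [Real.log_mul (by positivity) (Real.exp_pos _).ne', Real.log_exp, Real.log_pow, Real.log_inv,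
    Real.log_sqrt (by positivity)]
  ring

/-- Completing the square: the joint density of two independent observations with the same mean
is the density of their difference times the density of their precision-weighted mean. -/
lemma gaussianKernel_mul_gaussianKernel {d : ℕ} {v w : ℝ} (hv : 0 < v) (hw : 0 < w)
    (p q : EuclideanSpace ℝ (Fin d)) :
    gaussianKernel v p * gaussianKernel w q
      = gaussianKernel (v + w) (p - q)
        * gaussianKernel (v * w / (v + w)) ((w / (v + w)) • p + (v / (v + w)) • q) := by
  have hpi := Real.pi_pos
  have hvw : 0 < v + w := by positivity
  have hc : (√(2 * Real.pi * v))⁻¹ * (√(2 * Real.pi * w))⁻¹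
      = (√(2 * Real.pi * (v + w)))⁻¹ * (√(2 * Real.pi * (v * w / (v + w))))⁻¹ := by
    rw [← mul_inv, ← mul_inv, ← Real.sqrt_mul (by positivity), ← Real.sqrt_mul (by positivity)]
    congr 2
    field_simp
  have he : -‖p‖ ^ 2 / (2 * v) + -‖q‖ ^ 2 / (2 * w)
      = -‖p - q‖ ^ 2 / (2 * (v + w))
        + -‖(w / (v + w)) • p + (v / (v + w)) • q‖ ^ 2 / (2 * (v * w / (v + w))) := by
    rw [norm_sub_sq_real, norm_add_sq_real, norm_smul, norm_smul, real_inner_smul_left,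
      real_inner_smul_right, Real.norm_of_nonneg (by positivity), Real.norm_of_nonneg (by positivity)]
    field_simp
    ring
  unfold gaussianKernel
  calc _ = ((√(2 * Real.pi * v))⁻¹ * (√(2 * Real.pi * w))⁻¹) ^ d
        * Real.exp (-‖p‖ ^ 2 / (2 * v) + -‖q‖ ^ 2 / (2 * w)) := by
        rw [Real.exp_add, mul_pow]; ring
    _ = _ := by rw [hc, he, Real.exp_add, mul_pow]; ring

lemma normalDensity_eq {d : ℕ} (θ : EuclideanSpace ℝ (Fin d)) (v : ℝ≥0)
    (x : EuclideanSpace ℝ (Fin d)) :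
    normalDensity θ v x = ENNReal.ofReal (gaussianKernel v (x - θ)) := by
  unfold normalDensity gaussianPDF
  rw [← ENNReal.ofReal_prod_of_nonneg fun i _ => gaussianPDFReal_nonneg _ _ _]
  congr 1
  unfold gaussianPDFReal gaussianKernel
  rw [Finset.prod_mul_distrib, ← Real.exp_sum, EuclideanSpace.norm_sq_eq, ← Finset.sum_div,
    Finset.sum_neg_distrib]
  simp

instance isProbabilityMeasure_normalLaw {d : ℕ} (θ : EuclideanSpace ℝ (Fin d)) (v : ℝ≥0) :
    IsProbabilityMeasure (normalLaw θ v) := by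
  unfold normalLaw
  exact Measure.isProbabilityMeasure_map (by fun_prop)

lemma normalLaw_eq_withDensity {d : ℕ} (θ : EuclideanSpace ℝ (Fin d)) {v : ℝ≥0} (hv : v ≠ 0) :
    normalLaw θ v
      = volume.withDensity fun x => ENNReal.ofReal (gaussianKernel v (x - θ)) := by
  have hpi : (Measure.pi fun i => gaussianReal (θ i) v)
      = (volume : Measure (Fin d → ℝ)).withDensity
          fun x => ∏ i, gaussianPDF (θ i) v (x i) := by
    refine Measure.pi_eq fun s hs => ?_
    have hreal : ∀ x : Fin d → ℝ, (Set.univ.pi s).indicator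
        (fun x => ∏ i, gaussianPDF (θ i) v (x i)) x
        = ENNReal.ofReal (∏ i, (s i).indicator (gaussianPDFReal (θ i) v) (x i)) := by
      intro x
      rw [ENNReal.ofReal_prod_of_nonneg fun i _ =>
        Set.indicator_nonneg (fun y _ => gaussianPDFReal_nonneg _ _ y) _]
      by_cases hx : x ∈ Set.univ.pi s
      · rw [Set.indicator_of_mem hx]
        refine Finset.prod_congr rfl fun i _ => ?_
        rw [Set.indicator_of_mem (hx i (Set.mem_univ i))]
        rfl
      · rw [Set.indicator_of_notMem hx]
        simp only [Set.mem_pi, Set.mem_univ, forall_const, not_forall] at hx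
        obtain ⟨i, hi⟩ := hx
        refine (Finset.prod_eq_zero (Finset.mem_univ i) ?_).symm
        rw [Set.indicator_of_notMem hi, ENNReal.ofReal_zero]
    have hint : ∀ i, Integrable ((s i).indicator (gaussianPDFReal (θ i) v)) :=
      fun i => (integrable_gaussianPDFReal _ _).indicator (hs i)
    rw [withDensity_apply _ (MeasurableSet.univ_pi hs),
      ← lintegral_indicator (MeasurableSet.univ_pi hs)]
    simp_rw [hreal]
    rw [← ofReal_integral_eq_lintegral_ofReal
      (volume_pi (ι := Fin d) (α := fun _ => ℝ) ▸ Integrable.fintype_prod hint)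
      (ae_of_all _ fun x => Finset.prod_nonneg fun i _ =>
        Set.indicator_nonneg (fun y _ => gaussianPDFReal_nonneg _ _ y) _),
      integral_fintype_prod_volume_eq_prod,
      ENNReal.ofReal_prod_of_nonneg fun i _ => integral_nonneg fun y =>
        Set.indicator_nonneg (fun y _ => gaussianPDFReal_nonneg _ _ y) _]
    refine Finset.prod_congr rfl fun i _ => ?_
    rw [gaussianReal_apply_eq_integral _ hv, integral_indicator (hs i)]
  unfold normalLaw
  rw [hpi]
  ext t ht
  rw [Measure.map_apply (by fun_prop) ht, withDensity_apply _ ht,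
    withDensity_apply _ (by measurability),
    ← (PiLp.volume_preserving_toLp (Fin d)).setLIntegral_comp_preimage_emb
      (MeasurableEquiv.toLp 2 (Fin d → ℝ)).measurableEmbedding]
  refine lintegral_congr fun x => ?_
  rw [← normalDensity_eq]
  rfl

lemma charFun_normalLaw {d : ℕ} (θ : EuclideanSpace ℝ (Fin d)) (v : ℝ≥0)
    (t : EuclideanSpace ℝ (Fin d)) :
    charFun (normalLaw θ v) t
      = Complex.exp (Complex.I * inner ℝ t θ - v * ‖t‖ ^ 2 / 2) := by
  unfold normalLaw
  rw [charFun_pi]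
  simp_rw [charFun_gaussianReal, ← Complex.exp_sum]
  congr 1
  rw [Finset.sum_sub_distrib, ← Complex.ofReal_pow, EuclideanSpace.norm_sq_eq, PiLp.inner_apply]
  push_cast
  rw [Finset.mul_sum, Finset.mul_sum, Finset.sum_div]
  congr 1
  · refine Finset.sum_congr rfl fun i _ => ?_
    simp
    ring
  · refine Finset.sum_congr rfl fun i _ => ?_
    simp [← Complex.ofReal_pow]

/-- Every normal law is an affine image of the standard one. -/
lemma normalLaw_eq_map {d : ℕ} (θ : EuclideanSpace ℝ (Fin d)) (v : ℝ≥0) :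
    normalLaw θ v = (normalLaw (0 : EuclideanSpace ℝ (Fin d)) 1).map
      fun x => θ + (√(v : ℝ)) • x := by
  have hpi : (Measure.pi fun i => gaussianReal (θ i) v)
      = (Measure.pi fun _ : Fin d => gaussianReal 0 1).map (fun x i => θ i + √(v : ℝ) * x i) := by
    rw [Measure.pi_map_pi (f := fun i y => θ i + √(v : ℝ) * y) (fun i => by fun_prop)]
    congr 1
    funext i
    have : (fun y : ℝ => θ i + √(v : ℝ) * y) = (fun x => θ i + x) ∘ fun x => √(v : ℝ) * x := rfl
    rw [this, ← Measure.map_map (by fun_prop) (by fun_prop), gaussianReal_map_const_mul,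
      gaussianReal_map_const_add]
    congr 1
    · simp
    · ext
      simp
  unfold normalLaw
  rw [hpi, Measure.map_map (by fun_prop) (by fun_prop),
    Measure.map_map (by fun_prop) (by fun_prop)]
  rfl

lemma integral_normalLaw_eq {d : ℕ} (θ : EuclideanSpace ℝ (Fin d)) (v : ℝ≥0)
    (f : EuclideanSpace ℝ (Fin d) → ℝ) (hf : Measurable f) :
    ∫ x, f x ∂(normalLaw θ v)
      = ∫ x, f (θ + (√(v : ℝ)) • x) ∂(normalLaw (0 : EuclideanSpace ℝ (Fin d)) 1) := by
  rw [normalLaw_eq_map, integral_map (by fun_prop) hf.aestronglyMeasurable]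

instance isGaussian_normalLaw {d : ℕ} (θ : EuclideanSpace ℝ (Fin d)) (v : ℝ≥0) :
    IsGaussian (normalLaw θ v) := by
  have h1 : IsGaussian (normalLaw (0 : EuclideanSpace ℝ (Fin d)) 1) := by
    have : normalLaw (0 : EuclideanSpace ℝ (Fin d)) 1 = stdGaussian _ := map_pi_eq_stdGaussian
    rw [this]
    infer_instance
  rw [normalLaw_eq_map]
  have : (normalLaw (0 : EuclideanSpace ℝ (Fin d)) 1).map (fun x => θ + (√(v : ℝ)) • x)
      = ((normalLaw (0 : EuclideanSpace ℝ (Fin d)) 1).map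
          (√(v : ℝ) • ContinuousLinearMap.id ℝ (EuclideanSpace ℝ (Fin d)))).map
            (fun x => θ + x) := by
    rw [Measure.map_map (by fun_prop) (by fun_prop)]
    rfl
  rw [this]
  infer_instance

lemma integrable_norm_sq_normalLaw {d : ℕ} (θ : EuclideanSpace ℝ (Fin d)) (v : ℝ≥0) :
    Integrable (fun x => ‖x‖ ^ 2) (normalLaw θ v) :=
  (IsGaussian.memLp_two_id (μ := normalLaw θ v)).integrable_norm_pow (by norm_num)

/-- A measurable function of at most quadratic growth is integrable for every normal law. -/
lemma integrable_normalLaw_of_abs_le {d : ℕ} (θ : EuclideanSpace ℝ (Fin d)) (v : ℝ≥0)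
    {f : EuclideanSpace ℝ (Fin d) → ℝ} (hf : Measurable f) {A B : ℝ}
    (h : ∀ x, |f x| ≤ A + B * ‖x‖ ^ 2) : Integrable f (normalLaw θ v) := by
  refine Integrable.mono' (g := fun x => A + B * ‖x‖ ^ 2) ?_ hf.aestronglyMeasurable
    (ae_of_all _ h)
  exact (integrable_const A).add ((integrable_norm_sq_normalLaw θ v).const_mul B)

lemma integral_norm_sq_normalLaw {d : ℕ} (θ : EuclideanSpace ℝ (Fin d)) (v : ℝ≥0) :
    ∫ x, ‖x‖ ^ 2 ∂(normalLaw θ v) = d * v + ‖θ‖ ^ 2 := by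
  have hone : ∀ i, ∫ y : ℝ, y ^ 2 ∂(gaussianReal (θ i) v) = v + θ i ^ 2 := by
    intro i
    have := variance_eq_sub (μ := gaussianReal (θ i) v) (X := id)
      (memLp_id_gaussianReal 2)
    rw [variance_id_gaussianReal] at this
    simp only [id, Pi.pow_apply, integral_id_gaussianReal] at this
    linarith
  have hint : ∀ i, Integrable (fun y : ℝ => y ^ 2) (gaussianReal (θ i) v) := by
    intro i
    have := (memLp_id_gaussianReal (μ := θ i) (v := v) 2).integrable_sq
    simpa using this
  unfold normalLaw
  rw [integral_map (by fun_prop) (by fun_prop)]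
  simp_rw [EuclideanSpace.norm_sq_eq, Real.norm_eq_abs, sq_abs]
  rw [integral_finsetSum _ fun i _ =>
    integrable_comp_eval (μ := fun i => gaussianReal (θ i) v) (hint i)]
  have : ∀ i, ∫ x : Fin d → ℝ, (x i) ^ 2 ∂(Measure.pi fun i => gaussianReal (θ i) v)
      = v + θ i ^ 2 := fun i => by
    rw [integral_comp_eval (μ := fun i => gaussianReal (θ i) v) (i := i)
      (f := fun y : ℝ => y ^ 2) (by fun_prop), hone]
  simp_rw [this, Finset.sum_add_distrib]
  simp

lemma integral_norm_sub_sq_normalLaw {d : ℕ} (θ : EuclideanSpace ℝ (Fin d)) (v : ℝ≥0) :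
    ∫ x, ‖x - θ‖ ^ 2 ∂(normalLaw θ v) = d * v := by
  rw [integral_normalLaw_eq _ _ _ (by fun_prop)]
  simp_rw [add_sub_cancel_left, norm_smul, mul_pow]
  rw [integral_const_mul, integral_norm_sq_normalLaw]
  simp [mul_comm]

/-- The precision-weighted mean of two independent normal observations with mean `θ` and variances
`v`, `w` is normal with mean `θ` and variance `v w / (v + w)`. -/
lemma map_prod_normalLaw {d : ℕ} (θ : EuclideanSpace ℝ (Fin d)) {v w : ℝ≥0} (hv : v ≠ 0) :
    ((normalLaw θ v).prod (normalLaw θ w)).map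
        (fun p => ((w : ℝ) / (v + w)) • p.1 + ((v : ℝ) / (v + w)) • p.2)
      = normalLaw θ (v * w / (v + w)) := by
  have hpos : (0 : ℝ) < v + w := by
    have : (0 : ℝ) < v := by positivity
    positivity
  have h1 : ((normalLaw θ v).prod (normalLaw θ w)).map
        (fun p => ((w : ℝ) / (v + w)) • p.1 + ((v : ℝ) / (v + w)) • p.2)
      = ((normalLaw θ v).map (fun x => ((w : ℝ) / (v + w)) • x))
          ∗ ((normalLaw θ w).map (fun x => ((v : ℝ) / (v + w)) • x)) := by
    unfold Measure.conv
    rw [Measure.map_prod_map _ _ (by fun_prop) (by fun_prop),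
      Measure.map_map (by fun_prop) (by fun_prop)]
    rfl
  have i1 : IsProbabilityMeasure ((normalLaw θ v).map (fun x => ((w : ℝ) / (v + w)) • x)) :=
    Measure.isProbabilityMeasure_map (by fun_prop)
  have i2 : IsProbabilityMeasure ((normalLaw θ w).map (fun x => ((v : ℝ) / (v + w)) • x)) :=
    Measure.isProbabilityMeasure_map (by fun_prop)
  rw [h1]
  refine Measure.ext_of_charFun (funext fun t => ?_)
  rw [charFun_conv, charFun_map_smul, charFun_map_smul, charFun_normalLaw, charFun_normalLaw,
    charFun_normalLaw, ← Complex.exp_add]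
  congr 1
  have hne : ((v : ℝ) : ℂ) + ((w : ℝ) : ℂ) ≠ 0 := by exact_mod_cast hpos.ne'
  rw [norm_smul, norm_smul, real_inner_smul_left, real_inner_smul_left,
    Real.norm_of_nonneg (by positivity), Real.norm_of_nonneg (by positivity)]
  push_cast
  field_simp
  ring

/-! ### The Kullback–Leibler risk of a Bayesian predictive distribution -/

/-- The precision-weighted mean of observations `x` and `y` with variances `v` and `w`. -/
def pooledMean {d : ℕ} (v w : ℝ) (x y : EuclideanSpace ℝ (Fin d)) : EuclideanSpace ℝ (Fin d) :=
  (w / (v + w)) • x + (v / (v + w)) • y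

lemma measurable_pooledMean {d : ℕ} (v w : ℝ) :
    Measurable fun p : EuclideanSpace ℝ (Fin d) × EuclideanSpace ℝ (Fin d) =>
      pooledMean v w p.1 p.2 := by
  unfold pooledMean
  fun_prop

lemma measurable_ofReal_gaussianKernel {α : Type*} {_ : MeasurableSpace α} {d : ℕ} (s : ℝ)
    {f : α → EuclideanSpace ℝ (Fin d)} (hf : Measurable f) :
    Measurable fun a => ENNReal.ofReal (gaussianKernel s (f a)) :=
  ENNReal.measurable_ofReal.comp ((continuous_gaussianKernel s).measurable.comp hf)

lemma gaussianKernel_mul_eq_pooledMean {d : ℕ} {v w : ℝ} (hv : 0 < v) (hw : 0 < w)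
    (x y θ : EuclideanSpace ℝ (Fin d)) :
    gaussianKernel v (x - θ) * gaussianKernel w (y - θ)
      = gaussianKernel (v + w) (x - y)
        * gaussianKernel (v * w / (v + w)) (pooledMean v w x y - θ) := by
  rw [gaussianKernel_mul_gaussianKernel hv hw, sub_sub_sub_cancel_right]
  congr 2
  have h : w / (v + w) + v / (v + w) = 1 := by
    rw [← add_div, add_comm, div_self (by positivity)]
  calc _ = pooledMean v w x y - (w / (v + w) + v / (v + w)) • θ := by
        unfold pooledMean
        module
    _ = _ := by rw [h, one_smul]

/-- If the marginal densities of an observation under the prior are `exp ℓv` at variance `v` and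
`exp ℓu` at the pooled variance `v w / (v + w)`, then the predictive density of `y` given `x` is
`exp (ℓu z - ℓv x)` times the density of `y - x` at variance `v + w`, where `z` is the pooled mean.
-/
lemma bayesPredictive_eq_withDensity {d : ℕ} (prior : Measure (EuclideanSpace ℝ (Fin d)))
    [SFinite prior] {v w : ℝ≥0} (hv : v ≠ 0) (hw : w ≠ 0)
    {lv lu : EuclideanSpace ℝ (Fin d) → ℝ}
    (hMv : ∀ x, marginalDensity prior v x = ENNReal.ofReal (Real.exp (lv x)))
    (hMu : ∀ x, marginalDensity prior (v * w / (v + w)) x = ENNReal.ofReal (Real.exp (lu x)))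
    (x : EuclideanSpace ℝ (Fin d)) :
    bayesPredictive prior v w x = volume.withDensity fun y =>
      ENNReal.ofReal (gaussianKernel (v + w) (x - y)
        * Real.exp (lu (pooledMean v w x y) - lv x)) := by
  have hv' : (0 : ℝ) < v := by positivity
  have hw' : (0 : ℝ) < w := by positivity
  ext S hS
  rw [bayesPredictive, Measure.bind_apply hS (measurable_normalLaw w).aemeasurable, posteriorLaw,
    lintegral_smul_measure, withDensity_apply _ hS]
  simp_rw [normalDensity_eq]
  have hNS : Measurable fun θ : EuclideanSpace ℝ (Fin d) => normalLaw θ w S :=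
    (Measure.measurable_coe hS).comp (measurable_normalLaw w)
  rw [lintegral_withDensity_eq_lintegral_mul _
    (measurable_ofReal_gaussianKernel v (by fun_prop)) hNS]
  have hpt : ∀ θ y : EuclideanSpace ℝ (Fin d),
      ENNReal.ofReal (gaussianKernel v (x - θ)) * ENNReal.ofReal (gaussianKernel w (y - θ))
        = ENNReal.ofReal (gaussianKernel (v + w) (x - y))
          * ENNReal.ofReal (gaussianKernel ((v * w / (v + w) : ℝ≥0) : ℝ)
            (pooledMean v w x y - θ)) := by
    intro θ y
    rw [← ENNReal.ofReal_mul (gaussianKernel_pos hv' _).le,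
      ← ENNReal.ofReal_mul (gaussianKernel_pos (by positivity) _).le,
      gaussianKernel_mul_eq_pooledMean hv' hw']
    push_cast
    rfl
  simp only [Pi.mul_apply]
  have hswap : ∫⁻ θ, ENNReal.ofReal (gaussianKernel v (x - θ)) * (normalLaw θ w) S ∂prior
      = ∫⁻ y in S, ENNReal.ofReal (gaussianKernel (v + w) (x - y))
          * marginalDensity prior (v * w / (v + w)) (pooledMean v w x y) := by
    calc _ = ∫⁻ θ, (∫⁻ y in S, ENNReal.ofReal (gaussianKernel (v + w) (x - y))
          * ENNReal.ofReal (gaussianKernel ((v * w / (v + w) : ℝ≥0) : ℝ)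
            (pooledMean v w x y - θ))) ∂prior := by
          refine lintegral_congr fun θ => ?_
          rw [normalLaw_eq_withDensity θ hw, withDensity_apply _ hS,
            ← lintegral_const_mul _ (measurable_ofReal_gaussianKernel _ (by fun_prop))]
          exact lintegral_congr fun y => hpt θ y
      _ = _ := by
          rw [lintegral_lintegral_swap]
          · refine lintegral_congr fun y => ?_
            rw [lintegral_const_mul _ (measurable_ofReal_gaussianKernel _ (by fun_prop))]
            unfold marginalDensity
            simp_rw [normalDensity_eq]
          · have hz : Measurable fun p : EuclideanSpace ℝ (Fin d) × EuclideanSpace ℝ (Fin d) =>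
                pooledMean v w x p.2 - p.1 := by
              unfold pooledMean
              fun_prop
            exact ((measurable_ofReal_gaussianKernel _ (by fun_prop)).mul
              (measurable_ofReal_gaussianKernel _ hz)).aemeasurable
  rw [smul_eq_mul, hswap, hMv, ← ENNReal.ofReal_inv_of_pos (Real.exp_pos _), ← Real.exp_neg,
    ← lintegral_const_mul' _ _ ENNReal.ofReal_ne_top]
  refine lintegral_congr fun y => ?_
  rw [hMu, ← ENNReal.ofReal_mul (gaussianKernel_pos (by positivity) _).le,
    ← ENNReal.ofReal_mul (Real.exp_pos _).le, sub_eq_add_neg (lu _), Real.exp_add]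
  congr 1
  ring

lemma isProbabilityMeasure_bayesPredictive {d : ℕ} (prior : Measure (EuclideanSpace ℝ (Fin d)))
    (v w : ℝ≥0) (x : EuclideanSpace ℝ (Fin d)) (h0 : marginalDensity prior v x ≠ 0)
    (htop : marginalDensity prior v x ≠ ∞) :
    IsProbabilityMeasure (bayesPredictive prior v w x) := by
  refine ⟨?_⟩
  rw [bayesPredictive, Measure.bind_apply .univ (measurable_normalLaw w).aemeasurable]
  simp only [measure_univ, lintegral_const, one_mul]
  rw [posteriorLaw, Measure.smul_apply, withDensity_apply _ .univ, Measure.restrict_univ,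
    smul_eq_mul]
  exact ENNReal.inv_mul_cancel h0 htop

/-- If `μ` has the density `exp g` with respect to `ν`, both being probability measures, then the
Kullback–Leibler divergence of `μ` from `ν` is the mean of `g`. -/
lemma klDiv_of_eq_withDensity_exp {α : Type*} {_ : MeasurableSpace α} {μ ν : Measure α}
    [IsProbabilityMeasure μ] [IsProbabilityMeasure ν] {g : α → ℝ} (hg : Measurable g)
    (h : μ = ν.withDensity fun x => ENNReal.ofReal (Real.exp (g x))) (hint : Integrable g μ) :
    InformationTheory.klDiv μ ν = ENNReal.ofReal (∫ x, g x ∂μ) ∧ 0 ≤ ∫ x, g x ∂μ := by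
  have hac : μ ≪ ν := h ▸ withDensity_absolutelyContinuous _ _
  have hllr : llr μ ν =ᵐ[μ] g := by
    have h1 : μ.rnDeriv ν =ᵐ[ν] fun x => ENNReal.ofReal (Real.exp (g x)) := by
      conv_lhs => rw [h]
      exact Measure.rnDeriv_withDensity _ (by fun_prop)
    filter_upwards [hac.ae_le h1] with x hx
    simp only [llr_def]
    rw [hx, ENNReal.toReal_ofReal (Real.exp_pos _).le, Real.log_exp]
  have hi : Integrable (llr μ ν) μ := hint.congr hllr.symm
  rw [← integral_congr_ae hllr]
  refine ⟨?_, ?_⟩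
  · rw [InformationTheory.klDiv_of_ac_of_integrable hac hi]
    simp
  · have := InformationTheory.integral_llr_add_sub_measure_univ_nonneg hac hi
    simpa using this

/-- **Risk formula.** The risk of a Bayesian predictive distribution depends on the prior only
through the mean log marginal densities at the variance `v` of the observation and at the variance
`v w / (v + w)` of the pooled mean. -/
theorem klRisk_bayesPredictive {d : ℕ} (prior : Measure (EuclideanSpace ℝ (Fin d)))
    [SFinite prior] {v w : ℝ≥0} (hv : v ≠ 0) (hw : w ≠ 0)
    {lv lu : EuclideanSpace ℝ (Fin d) → ℝ} (hlv : Measurable lv) (hlu : Measurable lu)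
    (hMv : ∀ x, marginalDensity prior v x = ENNReal.ofReal (Real.exp (lv x)))
    (hMu : ∀ x, marginalDensity prior (v * w / (v + w)) x = ENNReal.ofReal (Real.exp (lu x)))
    {A B : ℝ} (hbv : ∀ x, |lv x| ≤ A + B * ‖x‖ ^ 2)
    {A' B' : ℝ} (hbu : ∀ x, |lu x| ≤ A' + B' * ‖x‖ ^ 2)
    (θ : EuclideanSpace ℝ (Fin d)) :
    klRisk v w θ (bayesPredictive prior v w)
      = ENNReal.ofReal ((d : ℝ) / 2 * Real.log (v / (v * w / (v + w)))
          + ∫ x, lv x ∂(normalLaw θ v) - ∫ x, lu x ∂(normalLaw θ (v * w / (v + w)))) := by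
  have hv' : (0 : ℝ) < v := by positivity
  have hw' : (0 : ℝ) < w := by positivity
  set u : ℝ≥0 := v * w / (v + w) with hu
  have huR : (u : ℝ) = v * w / (v + w) := by rw [hu]; push_cast; rfl
  have hu' : (0 : ℝ) < u := by rw [huR]; positivity
  -- `K s l z` is the log density of `N(θ, s)` at `z` relative to the marginal density `exp l`.
  let K : ℝ → (EuclideanSpace ℝ (Fin d) → ℝ) → EuclideanSpace ℝ (Fin d) → ℝ :=
    fun s l z => Real.log (gaussianKernel s (z - θ)) - l z
  have hKmeas : ∀ s l, Measurable l → Measurable (K s l) := fun s l hl =>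
    (Real.measurable_log.comp
      ((continuous_gaussianKernel s).comp (by fun_prop)).measurable).sub hl
  have hsq : ∀ t : ℝ≥0, Integrable (fun z => ‖z - θ‖ ^ 2) (normalLaw θ t) := fun t => by
    refine integrable_normalLaw_of_abs_le θ t (by fun_prop) (A := 2 * ‖θ‖ ^ 2) (B := 2)
      fun z => ?_
    rw [abs_of_nonneg (by positivity)]
    have := norm_sub_le z θ
    have h0 := norm_nonneg (z - θ)
    nlinarith [sq_nonneg (‖z‖ - ‖θ‖)]
  have hK : ∀ (s : ℝ≥0) (l : EuclideanSpace ℝ (Fin d) → ℝ), (0 : ℝ) < s →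
      Integrable l (normalLaw θ s) → Integrable (K s l) (normalLaw θ s) ∧
      ∫ z, K s l z ∂(normalLaw θ s)
        = -((d : ℝ) / 2 * Real.log (2 * Real.pi * s)) - d / 2 - ∫ z, l z ∂(normalLaw θ s) := by
    intro s l hs hl
    have he : K s l = fun z => -((d : ℝ) / 2 * Real.log (2 * Real.pi * s))
        - ‖z - θ‖ ^ 2 / (2 * s) - l z := by
      funext z
      exact congrArg (· - l z) (log_gaussianKernel hs _)
    have hi1 := (hsq s).div_const (2 * (s : ℝ))
    have hi2 := (integrable_const (μ := normalLaw θ s)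
      (-((d : ℝ) / 2 * Real.log (2 * Real.pi * s)))).sub hi1
    rw [he]
    refine ⟨hi2.sub hl, ?_⟩
    rw [integral_sub (by exact hi2) hl, integral_sub (integrable_const _) hi1, integral_div,
      integral_norm_sub_sq_normalLaw]
    simp only [integral_const, probReal_univ, one_smul]
    field_simp
  obtain ⟨hKv, hKv'⟩ := hK v lv hv' (integrable_normalLaw_of_abs_le θ v hlv hbv)
  obtain ⟨hKu, hKu'⟩ := hK u lu hu' (integrable_normalLaw_of_abs_le θ u hlu hbu)
  have hmap := map_prod_normalLaw θ (w := w) hv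
  rw [← hu] at hmap
  have hpm := measurable_pooledMean (d := d) v w
  have hKprod : Integrable (fun p : EuclideanSpace ℝ (Fin d) × EuclideanSpace ℝ (Fin d) =>
      K u lu (pooledMean v w p.1 p.2)) ((normalLaw θ v).prod (normalLaw θ w)) := by
    have hKu := hKu
    rw [← hmap] at hKu
    exact (integrable_map_measure (hKmeas u lu hlu).aestronglyMeasurable hpm.aemeasurable).1 hKu
  have hKprod' : ∫ x, ∫ y, K u lu (pooledMean v w x y) ∂(normalLaw θ w) ∂(normalLaw θ v)
      = ∫ z, K u lu z ∂(normalLaw θ u) := by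
    rw [← integral_prod _ hKprod, ← hmap,
      integral_map (by fun_prop) (hKmeas _ _ hlu).aestronglyMeasurable]
    rfl
  let g : EuclideanSpace ℝ (Fin d) → EuclideanSpace ℝ (Fin d) → ℝ :=
    fun x y => K u lu (pooledMean v w x y) - K v lv x
  have hgmeas : ∀ x, Measurable (g x) := fun x =>
    ((hKmeas u lu hlu).comp (hpm.comp (measurable_const.prodMk measurable_id))).sub
      measurable_const
  have hdens : ∀ x, normalLaw θ w = (bayesPredictive prior v w x).withDensity
      fun y => ENNReal.ofReal (Real.exp (g x y)) := by
    intro x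
    have hm : Measurable fun y => ENNReal.ofReal (gaussianKernel (v + w) (x - y)
        * Real.exp (lu (pooledMean v w x y) - lv x)) := by
      refine ENNReal.measurable_ofReal.comp (Measurable.mul ?_ ?_)
      · exact ((continuous_gaussianKernel _).comp (by fun_prop)).measurable
      · exact Real.measurable_exp.comp
          ((hlu.comp (hpm.comp (measurable_const.prodMk measurable_id))).sub measurable_const)
    have hm' : Measurable fun y => ENNReal.ofReal (Real.exp (g x y)) :=
      ENNReal.measurable_ofReal.comp (Real.measurable_exp.comp (hgmeas x))
    rw [bayesPredictive_eq_withDensity prior hv hw hMv hMu x, ← withDensity_mul _ hm hm',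
      normalLaw_eq_withDensity θ hw]
    congr 1
    funext y
    have h1 := gaussianKernel_pos hv' (x - θ)
    have h2 := gaussianKernel_pos hu' (pooledMean v w x y - θ)
    have h3 := gaussianKernel_mul_eq_pooledMean hv' hw' x y θ
    rw [← huR] at h3
    rw [Pi.mul_apply, ← ENNReal.ofReal_mul (by
      have := gaussianKernel_pos (d := d) (add_pos hv' hw') (x - y)
      positivity)]
    congr 1
    have h4 : g x y = Real.log (gaussianKernel u (pooledMean v w x y - θ))
        - Real.log (gaussianKernel v (x - θ)) - (lu (pooledMean v w x y) - lv x) := by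
      simp only [g, K]
      ring
    rw [h4]
    generalize lu (pooledMean v w x y) - lv x = c
    have h5 := Real.exp_pos c
    rw [Real.exp_sub, Real.exp_sub, Real.exp_log h1, Real.exp_log h2]
    field_simp
    linarith
  have hgint : ∀ᵐ x ∂(normalLaw θ v), Integrable (g x) (normalLaw θ w) := by
    filter_upwards [hKprod.prod_right_ae] with x hx
    exact hx.sub (integrable_const _)
  have hkl : ∀ᵐ x ∂(normalLaw θ v),
      InformationTheory.klDiv (normalLaw θ w) (bayesPredictive prior v w x)
        = ENNReal.ofReal (∫ y, g x y ∂(normalLaw θ w)) ∧ 0 ≤ ∫ y, g x y ∂(normalLaw θ w) := by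
    filter_upwards [hgint] with x hx
    have := isProbabilityMeasure_bayesPredictive prior v w x
      (by rw [hMv]; simp [Real.exp_pos]) (by rw [hMv]; exact ENNReal.ofReal_ne_top)
    exact klDiv_of_eq_withDensity_exp (hgmeas x) (hdens x) hx
  have hgeq : ∀ᵐ x ∂(normalLaw θ v), ∫ y, g x y ∂(normalLaw θ w)
      = ∫ y, K u lu (pooledMean v w x y) ∂(normalLaw θ w) - K v lv x := by
    filter_upwards [hKprod.prod_right_ae] with x hx
    rw [integral_sub hx (integrable_const _)]
    simp
  have hint : Integrable (fun x => ∫ y, g x y ∂(normalLaw θ w)) (normalLaw θ v) :=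
    (hKprod.integral_prod_left.sub hKv).congr (hgeq.mono fun x hx => hx.symm)
  rw [klRisk, lintegral_congr_ae (hkl.mono fun x hx => hx.1),
    ← ofReal_integral_eq_lintegral_ofReal hint (hkl.mono fun x hx => hx.2),
    integral_congr_ae hgeq, integral_sub hKprod.integral_prod_left hKv, hKprod', hKu', hKv']
  congr 1
  rw [← huR, Real.log_div hv'.ne' hu'.ne', Real.log_mul (by positivity) hv'.ne',
    Real.log_mul (by positivity) hu'.ne']
  ring

/-! ### Gaussian priors and the oracle risk -/

lemma gaussianKernel_neg {d : ℕ} (s : ℝ) (z : EuclideanSpace ℝ (Fin d)) :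
    gaussianKernel s (-z) = gaussianKernel s z := by
  simp [gaussianKernel]

lemma lintegral_gaussianKernel_sub {d : ℕ} {s : ℝ} (hs : 0 < s)
    (z : EuclideanSpace ℝ (Fin d)) :
    ∫⁻ θ, ENNReal.ofReal (gaussianKernel s (z - θ)) = 1 := by
  lift s to ℝ≥0 using hs.le
  have h := measure_univ (μ := normalLaw z s)
  rw [normalLaw_eq_withDensity z (by exact_mod_cast hs.ne'), withDensity_apply _ .univ,
    Measure.restrict_univ] at h
  rw [← h]
  refine lintegral_congr fun θ => ?_
  rw [← gaussianKernel_neg, neg_sub]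

/-- Convolution of two centred normal densities. -/
lemma lintegral_gaussianKernel_mul {d : ℕ} {s t : ℝ} (hs : 0 < s) (ht : 0 < t)
    (z : EuclideanSpace ℝ (Fin d)) :
    ∫⁻ θ, ENNReal.ofReal (gaussianKernel s (z - θ)) * ENNReal.ofReal (gaussianKernel t θ)
      = ENNReal.ofReal (gaussianKernel (s + t) z) := by
  have h : ∀ θ : EuclideanSpace ℝ (Fin d),
      ENNReal.ofReal (gaussianKernel s (z - θ)) * ENNReal.ofReal (gaussianKernel t θ)
        = ENNReal.ofReal (gaussianKernel (s + t) z)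
          * ENNReal.ofReal (gaussianKernel (s * t / (s + t)) (pooledMean s t z 0 - θ)) := by
    intro θ
    rw [← ENNReal.ofReal_mul (gaussianKernel_pos hs _).le,
      ← ENNReal.ofReal_mul (gaussianKernel_pos (by positivity) _).le,
      ← gaussianKernel_neg t θ, ← zero_sub θ, gaussianKernel_mul_eq_pooledMean hs ht, sub_zero]
  simp_rw [h]
  rw [lintegral_const_mul _ (measurable_ofReal_gaussianKernel _ (by fun_prop)),
    lintegral_gaussianKernel_sub (by positivity), mul_one]

lemma normalLaw_zero_var {d : ℕ} (θ : EuclideanSpace ℝ (Fin d)) :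
    normalLaw θ 0 = Measure.dirac θ := by
  rw [normalLaw_eq_map]
  simp [Measure.map_const]

lemma marginalDensity_gaussianPrior {d : ℕ} {s : ℝ≥0} (hs : s ≠ 0) (t : ℝ≥0)
    (z : EuclideanSpace ℝ (Fin d)) :
    marginalDensity (gaussianPrior d t) s z
      = ENNReal.ofReal (gaussianKernel ((s : ℝ) + t) z) := by
  unfold marginalDensity gaussianPrior
  simp_rw [normalDensity_eq]
  by_cases ht : t = 0
  · subst ht
    rw [normalLaw_zero_var, lintegral_dirac]
    simp
  · have hs' : (0 : ℝ) < s := by positivity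
    have ht' : (0 : ℝ) < t := by positivity
    rw [normalLaw_eq_withDensity 0 ht, lintegral_withDensity_eq_lintegral_mul _
      (measurable_ofReal_gaussianKernel _ (by fun_prop))
      (measurable_ofReal_gaussianKernel _ (by fun_prop)), ← lintegral_gaussianKernel_mul hs' ht']
    refine lintegral_congr fun θ => ?_
    rw [Pi.mul_apply, sub_zero, mul_comm]

/-- The risk at `θ` of the predictive distribution of the prior `N(0, t)`, where `a` stands for
`‖θ‖² / d`. -/
def gaussianPriorRisk (d : ℕ) (v u a t : ℝ) : ℝ :=
  (d : ℝ) / 2 * (Real.log (v / u) + Real.log ((u + t) / (v + t)) + (u + a) / (u + t)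
    - (v + a) / (v + t))

lemma klRisk_gaussianPrior {d : ℕ} (hd : 0 < d) {v w : ℝ≥0} (hv : v ≠ 0) (hw : w ≠ 0) (t : ℝ≥0)
    (θ : EuclideanSpace ℝ (Fin d)) :
    klRisk v w θ (bayesPredictive (gaussianPrior d t) v w)
      = ENNReal.ofReal (gaussianPriorRisk d v (v * w / (v + w)) (‖θ‖ ^ 2 / d) t) := by
  have hv' : (0 : ℝ) < v := by positivity
  have hw' : (0 : ℝ) < w := by positivity
  have hu0 : v * w / (v + w) ≠ 0 := by positivity
  have hM : ∀ {s : ℝ≥0}, s ≠ 0 → ∀ z : EuclideanSpace ℝ (Fin d),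
      marginalDensity (gaussianPrior d t) s z
        = ENNReal.ofReal (Real.exp (-((d : ℝ) / 2 * Real.log (2 * Real.pi * (s + t)))
            - ‖z‖ ^ 2 / (2 * (s + t)))) := by
    intro s hs z
    have hst : (0 : ℝ) < (s : ℝ) + t := by positivity
    rw [marginalDensity_gaussianPrior hs, ← log_gaussianKernel hst,
      Real.exp_log (gaussianKernel_pos hst z)]
  have hb : ∀ (s : ℝ≥0) (z : EuclideanSpace ℝ (Fin d)),
      |-((d : ℝ) / 2 * Real.log (2 * Real.pi * (s + t))) - ‖z‖ ^ 2 / (2 * (s + t))|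
        ≤ |(d : ℝ) / 2 * Real.log (2 * Real.pi * (s + t))|
          + 1 / (2 * ((s : ℝ) + t)) * ‖z‖ ^ 2 := by
    intro s z
    refine (abs_sub _ _).trans_eq ?_
    rw [abs_neg, abs_of_nonneg (a := ‖z‖ ^ 2 / (2 * ((s : ℝ) + t))) (by positivity)]
    ring
  have hI : ∀ {s : ℝ≥0}, s ≠ 0 → ∫ z, (-((d : ℝ) / 2 * Real.log (2 * Real.pi * (s + t)))
      - ‖z‖ ^ 2 / (2 * (s + t))) ∂(normalLaw θ s)
      = -((d : ℝ) / 2 * Real.log (2 * Real.pi * (s + t)))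
        - (d * s + ‖θ‖ ^ 2) / (2 * (s + t)) := by
    intro s hs
    rw [integral_sub (integrable_const _) ((integrable_norm_sq_normalLaw θ s).div_const _),
      integral_div, integral_norm_sq_normalLaw]
    simp
  have : SFinite (gaussianPrior d t) := by
    unfold gaussianPrior
    infer_instance
  rw [klRisk_bayesPredictive (gaussianPrior d t) hv hw (by fun_prop) (by fun_prop) (hM hv)
    (hM hu0) (hb _) (hb _) θ, hI hv, hI hu0]
  push_cast
  set u : ℝ := (v : ℝ) * w / (v + w) with hu
  have hu' : 0 < u := by positivity
  have ht := t.coe_nonneg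
  have hd' : (0 : ℝ) < d := by exact_mod_cast hd
  have hpi := Real.pi_pos
  congr 1
  unfold gaussianPriorRisk
  rw [Real.log_div (x := u + t) (by positivity) (by positivity),
    Real.log_mul (y := (v : ℝ) + t) (by positivity) (by positivity),
    Real.log_mul (y := u + t) (by positivity) (by positivity)]
  field_simp
  ring

lemma gaussianPriorRisk_self {d : ℕ} {v u a : ℝ} (hv : 0 < v) (hu : 0 < u) (ha : 0 ≤ a) :
    gaussianPriorRisk d v u a a = (d : ℝ) / 2 * Real.log ((1 + a / u) / (1 + a / v)) := by
  unfold gaussianPriorRisk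
  rw [div_self (by positivity), div_self (by positivity), add_sub_cancel_right,
    ← Real.log_mul (by positivity) (by positivity)]
  congr 2
  field_simp

/-- With `A = (u + a) / (u + t)` and `B = (v + a) / (v + t)`, the excess risk over the variance
`t = a` is a multiple of `(A - log A) - (B - log B)`, and `A` is farther than `B` from the
minimizer `1` of `x - log x`, on the same side. -/
lemma gaussianPriorRisk_self_le {d : ℕ} {v u a t : ℝ} (hu : 0 < u) (huv : u ≤ v) (ha : 0 ≤ a)
    (ht : 0 ≤ t) : gaussianPriorRisk d v u a a ≤ gaussianPriorRisk d v u a t := by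
  have hv : 0 < v := hu.trans_le huv
  unfold gaussianPriorRisk
  refine mul_le_mul_of_nonneg_left ?_ (by positivity)
  rw [div_self (by positivity), div_self (by positivity)]
  set A := (u + a) / (u + t) with hA
  set B := (v + a) / (v + t) with hB
  have hA0 : 0 < A := by positivity
  have hB0 : 0 < B := by positivity
  have hlog : Real.log ((u + a) / (v + a)) - Real.log ((u + t) / (v + t)) = Real.log (A / B) := by
    rw [← Real.log_div (by positivity) (by positivity)]
    congr 1
    rw [hA, hB]
    field_simp
  have h1 : Real.log (A / B) ≤ A / B - 1 := Real.log_le_sub_one_of_pos (by positivity)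
  have h2 : 0 ≤ (A - B) * (B - 1) := by
    have e1 : A - B = (a - t) * (v - u) / ((u + t) * (v + t)) := by
      rw [hA, hB]
      field_simp
      ring
    have e2 : B - 1 = (a - t) / (v + t) := by
      rw [hB]
      field_simp
      ring
    have e3 : (A - B) * (B - 1)
        = (a - t) ^ 2 * (v - u) / ((u + t) * (v + t) * (v + t)) := by
      rw [e1, e2]
      field_simp
    rw [e3]
    have := sub_nonneg.2 huv
    positivity
  have h3 : A / B - 1 ≤ A - B := by
    rw [div_sub_one hB0.ne', div_le_iff₀ hB0]
    linarith
  linarith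

/-- Among Gaussian priors, the risk at `θ` is least for the variance `‖θ‖² / d`. -/
theorem isLeast_klRisk_gaussianPrior {d : ℕ} (hd : 0 < d) {v w : ℝ≥0} (hv : v ≠ 0) (hw : w ≠ 0)
    (θ : EuclideanSpace ℝ (Fin d)) :
    IsLeast (Set.range fun t : ℝ≥0 => klRisk v w θ (bayesPredictive (gaussianPrior d t) v w))
      (ENNReal.ofReal ((d : ℝ) / 2 * Real.log ((1 + ‖θ‖ ^ 2 / d / ((v : ℝ) * w / (v + w)))
        / (1 + ‖θ‖ ^ 2 / d / v)))) := by
  have hv' : (0 : ℝ) < v := by positivity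
  have hw' : (0 : ℝ) < w := by positivity
  have hu' : (0 : ℝ) < (v : ℝ) * w / (v + w) := by positivity
  have huv : (v : ℝ) * w / (v + w) ≤ v := by
    rw [div_le_iff₀ (by positivity)]
    nlinarith
  have ha : 0 ≤ ‖θ‖ ^ 2 / d := by positivity
  rw [← gaussianPriorRisk_self hv' hu' ha]
  refine ⟨⟨⟨‖θ‖ ^ 2 / d, ha⟩, klRisk_gaussianPrior hd hv hw _ θ⟩, ?_⟩
  rintro _ ⟨t, rfl⟩
  simp only [klRisk_gaussianPrior hd hv hw]
  exact ENNReal.ofReal_le_ofReal (gaussianPriorRisk_self_le hu' huv ha t.coe_nonneg)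

/-! ### The radial profile of the marginal density under Stein's prior -/

/-- The Laplace transform `∫₀¹ p ^ (α - 1) exp (- p x / 2) dp`. With `α = d / 2 - 1`, the marginal
density at `z` under Stein's prior and variance `s` is a constant times
`s ^ (- α) * steinProfile α (‖z‖² / s)`. -/
def steinProfile (α x : ℝ) : ℝ := ∫ p in (0 : ℝ)..1, p ^ (α - 1) * Real.exp (-(p * x / 2))

lemma intervalIntegrable_steinProfile {α : ℝ} (hα : 0 < α) (x : ℝ) :
    IntervalIntegrable (fun p : ℝ => p ^ (α - 1) * Real.exp (-(p * x / 2))) volume 0 1 :=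
  (intervalIntegral.intervalIntegrable_rpow' (by linarith)).mul_continuousOn (by fun_prop)

lemma steinProfile_pos {α : ℝ} (hα : 0 < α) (x : ℝ) : 0 < steinProfile α x := by
  refine intervalIntegral.intervalIntegral_pos_of_pos_on (intervalIntegrable_steinProfile hα x)
    (fun p hp => ?_) one_pos
  have := Real.rpow_pos_of_pos hp.1 (α - 1)
  positivity

lemma steinProfile_add_one_le {α : ℝ} (hα : 0 < α) (x : ℝ) :
    steinProfile (α + 1) x ≤ steinProfile α x := by
  refine intervalIntegral.integral_mono_on_of_le_Ioo zero_le_one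
    (intervalIntegrable_steinProfile (by linarith) x) (intervalIntegrable_steinProfile hα x)
    fun p hp => ?_
  refine mul_le_mul_of_nonneg_right ?_ (Real.exp_pos _).le
  exact Real.rpow_le_rpow_of_exponent_ge hp.1 hp.2.le (by linarith)

lemma hasDerivAt_steinProfile {α : ℝ} (hα : 0 < α) (x : ℝ) :
    HasDerivAt (steinProfile α) (-(steinProfile (α + 1) x / 2)) x := by
  have hmeas : ∀ β y : ℝ, Measurable fun p : ℝ => p ^ (β - 1) * Real.exp (-(p * y / 2)) :=
    fun β y => by fun_prop
  have key := intervalIntegral.hasDerivAt_integral_of_dominated_loc_of_deriv_le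
    (μ := volume) (a := (0 : ℝ)) (b := 1) (s := Metric.ball x 1)
    (F := fun y p => p ^ (α - 1) * Real.exp (-(p * y / 2)))
    (F' := fun y p => p ^ (α - 1) * (Real.exp (-(p * y / 2)) * (-(p / 2)))) (x₀ := x)
    (bound := fun p => p ^ (α - 1) * Real.exp (|x| + 1))
    (Metric.ball_mem_nhds x one_pos)
    (Filter.Eventually.of_forall fun y => (hmeas α y).aestronglyMeasurable)
    (intervalIntegrable_steinProfile hα x)
    (by fun_prop)
    (ae_of_all _ fun p hp y hy => by
      rw [Set.uIoc_of_le zero_le_one] at hp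
      have h1 := Real.rpow_pos_of_pos hp.1 (α - 1)
      have hy' : |y| ≤ |x| + 1 := by
        have := Metric.mem_ball.1 hy
        rw [Real.dist_eq] at this
        have h2 := abs_sub_abs_le_abs_sub y x
        linarith
      rw [norm_mul, norm_mul, Real.norm_of_nonneg h1.le, Real.norm_of_nonneg (Real.exp_pos _).le]
      refine mul_le_mul_of_nonneg_left ?_ h1.le
      have h3 : ‖-(p / 2)‖ ≤ 1 := by
        rw [norm_neg, Real.norm_of_nonneg (by linarith [hp.1])]
        linarith [hp.2]
      have h4 : Real.exp (-(p * y / 2)) ≤ Real.exp (|x| + 1) := by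
        refine Real.exp_le_exp.2 ?_
        have h5 : p * -y ≤ |y| :=
          (mul_le_mul_of_nonneg_left (neg_le_abs y) hp.1.le).trans
            (mul_le_of_le_one_left (abs_nonneg y) hp.2)
        linarith [abs_nonneg x, abs_nonneg y]
      calc _ ≤ Real.exp (|x| + 1) * 1 := mul_le_mul h4 h3 (norm_nonneg _) (Real.exp_pos _).le
        _ = _ := mul_one _)
    ((intervalIntegral.intervalIntegrable_rpow' (by linarith)).mul_const _)
    (ae_of_all _ fun p _ y _ => by
      refine HasDerivAt.const_mul _ (HasDerivAt.exp ?_)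
      have := (((hasDerivAt_id y).const_mul p).div_const 2).fun_neg
      simpa using this)
  refine key.2.congr_deriv ?_
  symm
  unfold steinProfile
  rw [← intervalIntegral.integral_div, ← intervalIntegral.integral_neg]
  refine intervalIntegral.integral_congr_ae (ae_of_all _ fun p hp => ?_)
  rw [Set.uIoc_of_le zero_le_one] at hp
  rw [show α + 1 - 1 = α - 1 + 1 by ring, Real.rpow_add_one hp.1.ne']
  ring

/-- Integration by parts for the profile. -/
lemma mul_steinProfile_add_one {α : ℝ} (hα : 0 < α) (x : ℝ) :
    x / 2 * steinProfile (α + 1) x = α * steinProfile α x - Real.exp (-(x / 2)) := by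
  have hi1 := (intervalIntegrable_steinProfile hα x).const_mul α
  have hi2 := (intervalIntegrable_steinProfile (α := α + 1) (by linarith) x).const_mul (x / 2)
  have h := intervalIntegral.integral_eq_sub_of_hasDerivAt_of_le (a := (0 : ℝ)) (b := 1)
    (f := fun p => p ^ α * Real.exp (-(p * x / 2)))
    (f' := fun p => α * (p ^ (α - 1) * Real.exp (-(p * x / 2)))
      - x / 2 * (p ^ (α + 1 - 1) * Real.exp (-(p * x / 2)))) zero_le_one
    (ContinuousOn.mul (continuousOn_id.rpow_const fun _ _ => Or.inr hα.le) (by fun_prop))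
    (fun p hp => by
      have h1 := Real.hasDerivAt_rpow_const (x := p) (p := α) (Or.inl hp.1.ne')
      have h2 : HasDerivAt (fun p : ℝ => Real.exp (-(p * x / 2)))
          (Real.exp (-(p * x / 2)) * (-(x / 2))) p := by
        refine HasDerivAt.exp ?_
        simpa using (((hasDerivAt_id p).mul_const x).div_const 2).fun_neg
      refine (h1.mul h2).congr_deriv ?_
      rw [add_sub_cancel_right]
      ring)
    (hi1.sub hi2)
  rw [intervalIntegral.integral_sub hi1 hi2, intervalIntegral.integral_const_mul,
    intervalIntegral.integral_const_mul] at h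
  simp only [Real.one_rpow, Real.zero_rpow hα.ne', one_mul, zero_mul, sub_zero] at h
  unfold steinProfile
  linarith

/-- The derivative of `-log (steinProfile α)`. -/
def steinRate (α x : ℝ) : ℝ := steinProfile (α + 1) x / (2 * steinProfile α x)

lemma hasDerivAt_neg_log_steinProfile {α : ℝ} (hα : 0 < α) (x : ℝ) :
    HasDerivAt (fun x => -Real.log (steinProfile α x)) (steinRate α x) x := by
  have hp := steinProfile_pos hα x
  refine ((hasDerivAt_steinProfile hα x).log hp.ne').fun_neg.congr_deriv ?_
  unfold steinRate
  field_simp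

lemma continuous_steinProfile {α : ℝ} (hα : 0 < α) : Continuous (steinProfile α) :=
  continuous_iff_continuousAt.2 fun x => (hasDerivAt_steinProfile hα x).continuousAt

lemma continuous_steinRate {α : ℝ} (hα : 0 < α) : Continuous (steinRate α) :=
  (continuous_steinProfile (by linarith)).div ((continuous_steinProfile hα).const_mul 2)
    fun x => (mul_pos two_pos (steinProfile_pos hα x)).ne'

lemma steinRate_nonneg {α : ℝ} (hα : 0 < α) (x : ℝ) : 0 ≤ steinRate α x := by
  have h1 := steinProfile_pos hα x
  have h2 := steinProfile_pos (α := α + 1) (by linarith) x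
  unfold steinRate
  positivity

lemma steinRate_le_half {α : ℝ} (hα : 0 < α) (x : ℝ) : steinRate α x ≤ 1 / 2 := by
  have h1 := steinProfile_pos hα x
  unfold steinRate
  rw [div_le_iff₀ (by positivity)]
  linarith [steinProfile_add_one_le hα x]

lemma mul_steinRate_le {α : ℝ} (hα : 0 < α) (x : ℝ) : x * steinRate α x ≤ α := by
  have h1 := steinProfile_pos hα x
  unfold steinRate
  rw [mul_div_assoc', div_le_iff₀ (by positivity)]
  linarith [mul_steinProfile_add_one hα x, Real.exp_pos (-(x / 2))]

lemma abs_log_steinProfile_le {α : ℝ} (hα : 0 < α) {x : ℝ} (hx : 0 ≤ x) :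
    |Real.log (steinProfile α x)| ≤ |Real.log (steinProfile α 0)| + x / 2 := by
  have h0 := steinProfile_pos hα 0
  have hp := steinProfile_pos hα x
  have hle : steinProfile α x ≤ steinProfile α 0 := by
    refine intervalIntegral.integral_mono_on_of_le_Ioo zero_le_one
      (intervalIntegrable_steinProfile hα x) (intervalIntegrable_steinProfile hα 0) fun p hp => ?_
    refine mul_le_mul_of_nonneg_left (Real.exp_le_exp.2 ?_) (Real.rpow_nonneg hp.1.le _)
    have := mul_nonneg hp.1.le hx
    linarith
  have hge : Real.exp (-(x / 2)) * steinProfile α 0 ≤ steinProfile α x := by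
    unfold steinProfile
    rw [← intervalIntegral.integral_const_mul]
    refine intervalIntegral.integral_mono_on_of_le_Ioo zero_le_one
      ((intervalIntegrable_steinProfile hα 0).const_mul _)
      (intervalIntegrable_steinProfile hα x) fun p hp => ?_
    have h1 := Real.rpow_nonneg hp.1.le (α - 1)
    have h2 : Real.exp (-(x / 2)) ≤ Real.exp (-(p * x / 2)) := by
      refine Real.exp_le_exp.2 ?_
      nlinarith [hp.2]
    simp only [mul_zero, zero_div, neg_zero, Real.exp_zero, mul_one]
    rw [mul_comm]
    exact mul_le_mul_of_nonneg_left h2 h1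
  have hl1 := Real.log_le_log hp hle
  have hl2 := Real.log_le_log (by positivity) hge
  rw [Real.log_mul (Real.exp_pos _).ne' h0.ne', Real.log_exp] at hl2
  rw [abs_le]
  have h3 := neg_abs_le (Real.log (steinProfile α 0))
  have h4 := le_abs_self (Real.log (steinProfile α 0))
  constructor <;> linarith

/-! ### The marginal density under Stein's prior -/

/-- Stein's prior is a mixture of centred Gaussians with precisions `q`. -/
lemma rpow_norm_eq_lintegral {d : ℕ} (hd : 2 < d) {θ : EuclideanSpace ℝ (Fin d)} (hθ : θ ≠ 0) :
    ENNReal.ofReal (‖θ‖ ^ (2 - (d : ℝ)))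
      = ENNReal.ofReal ((2 ^ ((d : ℝ) / 2 - 1) * Real.Gamma ((d : ℝ) / 2 - 1))⁻¹)
        * ∫⁻ q in Set.Ioi (0 : ℝ),
          ENNReal.ofReal (q ^ ((d : ℝ) / 2 - 1 - 1) * Real.exp (-(‖θ‖ ^ 2 / 2 * q))) := by
  have hd' : (2 : ℝ) < d := by exact_mod_cast hd
  set α : ℝ := (d : ℝ) / 2 - 1 with hα
  have hα0 : 0 < α := by linarith
  have hn : 0 < ‖θ‖ := norm_pos_iff.2 hθ
  have hΓ := Real.Gamma_pos_of_pos hα0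
  have hI := Real.integral_rpow_mul_exp_neg_mul_Ioi hα0 (r := ‖θ‖ ^ 2 / 2) (by positivity)
  have hint : Integrable (fun q : ℝ => q ^ (α - 1) * Real.exp (-(‖θ‖ ^ 2 / 2 * q)))
      (volume.restrict (Set.Ioi 0)) := by
    refine Integrable.of_integral_ne_zero ?_
    rw [hI]
    positivity
  rw [← ofReal_integral_eq_lintegral_ofReal hint, hI, ← ENNReal.ofReal_mul (by positivity)]
  · congr 1
    have h1 : (1 / (‖θ‖ ^ 2 / 2)) ^ α = 2 ^ α * ‖θ‖ ^ (2 - (d : ℝ)) := by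
      rw [show 1 / (‖θ‖ ^ 2 / 2) = 2 * (‖θ‖ ^ (2 : ℕ))⁻¹ by field_simp,
        Real.mul_rpow (by positivity) (by positivity), Real.inv_rpow (by positivity),
        ← Real.rpow_natCast, ← Real.rpow_mul hn.le, ← Real.rpow_neg hn.le]
      congr 2
      rw [hα]
      push_cast
      ring
    rw [h1]
    have : (0 : ℝ) < 2 ^ α := by positivity
    field_simp
  · filter_upwards [ae_restrict_mem measurableSet_Ioi] with q hq
    have := Real.rpow_nonneg (le_of_lt hq) (α - 1)
    positivity

/-- The convolution of a Gaussian density of variance `s` with `exp (-q ‖θ‖² / 2)`. -/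
lemma lintegral_gaussianKernel_mul_exp {d : ℕ} {s q : ℝ} (hs : 0 < s) (hq : 0 < q)
    (z : EuclideanSpace ℝ (Fin d)) :
    ∫⁻ θ, ENNReal.ofReal (gaussianKernel s (z - θ))
        * ENNReal.ofReal (Real.exp (-(‖θ‖ ^ 2 / 2 * q)))
      = ENNReal.ofReal ((1 + s * q) ^ (-((d : ℝ) / 2))
          * Real.exp (-(q / (1 + s * q) * ‖z‖ ^ 2 / 2))) := by
  have hpi := Real.pi_pos
  have h : ∀ θ : EuclideanSpace ℝ (Fin d), ENNReal.ofReal (Real.exp (-(‖θ‖ ^ 2 / 2 * q)))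
      = ENNReal.ofReal (√(2 * Real.pi * q⁻¹) ^ d) * ENNReal.ofReal (gaussianKernel q⁻¹ θ) := by
    intro θ
    rw [← ENNReal.ofReal_mul (by positivity), gaussianKernel, ← mul_assoc, ← mul_pow,
      mul_inv_cancel₀ (by positivity), one_pow, one_mul]
    congr 2
    field_simp
  simp_rw [h, mul_left_comm]
  rw [lintegral_const_mul' _ _ ENNReal.ofReal_ne_top,
    lintegral_gaussianKernel_mul hs (by positivity), ← ENNReal.ofReal_mul (by positivity)]
  congr 1
  rw [gaussianKernel, ← mul_assoc, ← mul_pow, ← div_eq_mul_inv,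
    ← Real.sqrt_div (by positivity)]
  congr 1
  · rw [show 2 * Real.pi * q⁻¹ / (2 * Real.pi * (s + q⁻¹)) = (1 + s * q)⁻¹ by field_simp; ring,
      Real.sqrt_eq_rpow, ← Real.rpow_natCast, ← Real.rpow_mul (by positivity),
      Real.inv_rpow (by positivity), ← Real.rpow_neg (by positivity)]
    congr 1
    ring
  · congr 1
    field_simp
    ring

/-- Substituting `q = p / (s (1 - p))` in an integral over the precision `q`. -/
lemma lintegral_Ioi_eq_lintegral_Ioo {s : ℝ} (hs : 0 < s) (g : ℝ → ℝ≥0∞) :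
    ∫⁻ q in Set.Ioi (0 : ℝ), g q
      = ∫⁻ p in Set.Ioo (0 : ℝ) 1,
          ENNReal.ofReal (1 / (s * (1 - p) ^ 2)) * g (p / (s * (1 - p))) := by
  have himage : (fun p : ℝ => p / (s * (1 - p))) '' Set.Ioo 0 1 = Set.Ioi 0 := by
    ext q
    constructor
    · rintro ⟨p, hp, rfl⟩
      have : 0 < 1 - p := sub_pos.2 hp.2
      have := hp.1
      simp only [Set.mem_Ioi]
      positivity
    · intro hq
      have hq' : 0 < q := hq
      refine ⟨s * q / (1 + s * q), ⟨by positivity, ?_⟩, ?_⟩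
      · rw [div_lt_one (by positivity)]
        linarith
      · have h1 : 1 - s * q / (1 + s * q) = 1 / (1 + s * q) := by
          field_simp
          ring
        simp only [h1]
        field_simp
  have hinj : Set.InjOn (fun p : ℝ => p / (s * (1 - p))) (Set.Ioo 0 1) := by
    intro p hp r hr hpr
    have h1 : 0 < 1 - p := sub_pos.2 hp.2
    have h2 : 0 < 1 - r := sub_pos.2 hr.2
    simp only at hpr
    field_simp at hpr
    linarith
  have hderiv : ∀ p ∈ Set.Ioo (0 : ℝ) 1, HasDerivWithinAt (fun p : ℝ => p / (s * (1 - p)))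
      (1 / (s * (1 - p) ^ 2)) (Set.Ioo 0 1) p := by
    intro p hp
    have h1 : 0 < 1 - p := sub_pos.2 hp.2
    have h2 : HasDerivAt (fun p : ℝ => s * (1 - p)) (s * -1) p :=
      ((hasDerivAt_id p).const_sub 1).const_mul s
    refine (((hasDerivAt_id p).div h2 (by positivity)).congr_deriv ?_).hasDerivWithinAt
    simp only [id]
    field_simp
    ring
  rw [← himage, lintegral_image_eq_lintegral_abs_deriv_mul measurableSet_Ioo hderiv hinj]
  refine setLIntegral_congr_fun measurableSet_Ioo fun p hp => ?_
  have h1 : 0 < 1 - p := sub_pos.2 hp.2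
  rw [abs_of_nonneg (by positivity)]

lemma marginalDensity_steinPrior {d : ℕ} (hd : 2 < d) {s : ℝ≥0} (hs : s ≠ 0)
    (z : EuclideanSpace ℝ (Fin d)) :
    marginalDensity (steinPrior d) s z
      = ENNReal.ofReal ((2 ^ ((d : ℝ) / 2 - 1) * Real.Gamma ((d : ℝ) / 2 - 1))⁻¹
          * ((s : ℝ) ^ (-((d : ℝ) / 2 - 1))
            * steinProfile ((d : ℝ) / 2 - 1) (‖z‖ ^ 2 / s))) := by
  have hs' : (0 : ℝ) < s := by positivity
  have hd' : (2 : ℝ) < d := by exact_mod_cast hd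
  have hdn : Nonempty (Fin d) := ⟨⟨0, by omega⟩⟩
  set α : ℝ := (d : ℝ) / 2 - 1 with hα
  have hα0 : 0 < α := by linarith
  have hΓ := Real.Gamma_pos_of_pos hα0
  have hmeasq : Measurable fun p : EuclideanSpace ℝ (Fin d) × ℝ =>
      ENNReal.ofReal (p.2 ^ (α - 1) * Real.exp (-(‖p.1‖ ^ 2 / 2 * p.2))) := by fun_prop
  calc marginalDensity (steinPrior d) s z
      = ∫⁻ θ, ENNReal.ofReal (gaussianKernel s (z - θ))
          * ENNReal.ofReal (‖θ‖ ^ (2 - (d : ℝ))) := by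
        unfold marginalDensity steinPrior
        simp_rw [normalDensity_eq]
        rw [lintegral_withDensity_eq_lintegral_mul _ (by fun_prop)
          (measurable_ofReal_gaussianKernel _ (by fun_prop))]
        exact lintegral_congr fun θ => by rw [Pi.mul_apply, mul_comm]
    _ = ∫⁻ θ, ENNReal.ofReal ((2 ^ α * Real.Gamma α)⁻¹) * ∫⁻ q in Set.Ioi (0 : ℝ),
          ENNReal.ofReal (gaussianKernel s (z - θ))
          * ENNReal.ofReal (q ^ (α - 1) * Real.exp (-(‖θ‖ ^ 2 / 2 * q))) := by
        have : ∀ᵐ θ : EuclideanSpace ℝ (Fin d), θ ≠ 0 := by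
          simp [ae_iff]
        refine lintegral_congr_ae (this.mono fun θ hθ => ?_)
        simp only
        rw [rpow_norm_eq_lintegral hd hθ, lintegral_const_mul' _ _ ENNReal.ofReal_ne_top]
        exact mul_left_comm _ _ _
    _ = ENNReal.ofReal ((2 ^ α * Real.Gamma α)⁻¹) * ∫⁻ q in Set.Ioi (0 : ℝ),
          ENNReal.ofReal (q ^ (α - 1)) * ENNReal.ofReal ((1 + s * q) ^ (-((d : ℝ) / 2))
          * Real.exp (-(q / (1 + s * q) * ‖z‖ ^ 2 / 2))) := by
        rw [lintegral_const_mul' _ _ ENNReal.ofReal_ne_top, lintegral_lintegral_swap]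
        · congr 1
          refine setLIntegral_congr_fun measurableSet_Ioi fun q hq => ?_
          rw [← lintegral_gaussianKernel_mul_exp hs' hq,
            ← lintegral_const_mul' _ _ ENNReal.ofReal_ne_top]
          refine lintegral_congr fun θ => ?_
          rw [ENNReal.ofReal_mul (Real.rpow_nonneg (le_of_lt hq) _)]
          exact mul_left_comm _ _ _
        · exact ((measurable_ofReal_gaussianKernel _ (by fun_prop)).mul hmeasq).aemeasurable
    _ = ENNReal.ofReal ((2 ^ α * Real.Gamma α)⁻¹) * ∫⁻ p in Set.Ioo (0 : ℝ) 1,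
          ENNReal.ofReal ((s : ℝ) ^ (-α))
          * ENNReal.ofReal (p ^ (α - 1) * Real.exp (-(p * (‖z‖ ^ 2 / s) / 2))) := by
        rw [lintegral_Ioi_eq_lintegral_Ioo hs']
        congr 1
        refine setLIntegral_congr_fun measurableSet_Ioo fun p hp => ?_
        have h1 : 0 < 1 - p := sub_pos.2 hp.2
        have h0 := hp.1
        rw [← ENNReal.ofReal_mul (by positivity), ← ENNReal.ofReal_mul (by positivity),
          ← ENNReal.ofReal_mul (by positivity)]
        congr 1
        have e1 : 1 + s * (p / (s * (1 - p))) = (1 - p)⁻¹ := by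
          field_simp
          ring
        have e2 : (p / (s * (1 - p))) / (1 - p)⁻¹ * ‖z‖ ^ 2 / 2 = p * (‖z‖ ^ 2 / s) / 2 := by
          field_simp
        rw [e1, e2, Real.inv_rpow h1.le, Real.rpow_neg h1.le, inv_inv, ← mul_assoc, ← mul_assoc,
          ← mul_assoc ((s : ℝ) ^ (-α))]
        congr 1
        have e3 : (d : ℝ) / 2 = α - 1 + (2 : ℕ) := by
          rw [hα]
          push_cast
          ring
        have e4 : (s : ℝ) ^ (-α) = ((s : ℝ) ^ (α - 1))⁻¹ * (s : ℝ)⁻¹ := by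
          rw [← Real.rpow_neg hs'.le, ← Real.rpow_neg_one, ← Real.rpow_add hs']
          congr 1
          ring
        have h2 := Real.rpow_pos_of_pos h1 (α - 1)
        have h3 := Real.rpow_pos_of_pos hs' (α - 1)
        rw [e3, Real.rpow_add_natCast h1.ne', Real.div_rpow h0.le (by positivity),
          Real.mul_rpow hs'.le h1.le, e4]
        field_simp
    _ = _ := by
        have hint := (intervalIntegrable_iff_integrableOn_Ioo_of_le zero_le_one).1
          (intervalIntegrable_steinProfile hα0 (‖z‖ ^ 2 / s))
        rw [lintegral_const_mul' _ _ ENNReal.ofReal_ne_top,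
          ← ofReal_integral_eq_lintegral_ofReal hint, ← integral_Ioc_eq_integral_Ioo,
          ← intervalIntegral.integral_of_le zero_le_one, ← ENNReal.ofReal_mul (by positivity),
          ← ENNReal.ofReal_mul (by positivity)]
        · rfl
        · filter_upwards [ae_restrict_mem measurableSet_Ioo] with p hp
          have := Real.rpow_nonneg hp.1.le (α - 1)
          positivity

/-! ### Gaussian integrals: symmetrization and Stein's identity -/

lemma integral_normalLaw_eq_integral_mul {d : ℕ} (θ : EuclideanSpace ℝ (Fin d)) {v : ℝ≥0}
    (hv : v ≠ 0) (f : EuclideanSpace ℝ (Fin d) → ℝ) :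
    ∫ x, f x ∂(normalLaw θ v) = ∫ x, gaussianKernel v (x - θ) * f x := by
  rw [normalLaw_eq_withDensity θ hv, integral_withDensity_eq_integral_toReal_smul
    (measurable_ofReal_gaussianKernel _ (by fun_prop)) (ae_of_all _ fun _ => ENNReal.ofReal_lt_top)]
  refine integral_congr_ae (ae_of_all _ fun x => ?_)
  simp only [smul_eq_mul]
  rw [ENNReal.toReal_ofReal (gaussianKernel_pos (by positivity) _).le]

lemma integrable_normalLaw_iff {d : ℕ} (θ : EuclideanSpace ℝ (Fin d)) {v : ℝ≥0}
    (hv : v ≠ 0) (f : EuclideanSpace ℝ (Fin d) → ℝ) :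
    Integrable f (normalLaw θ v) ↔ Integrable fun x => gaussianKernel v (x - θ) * f x := by
  rw [normalLaw_eq_withDensity θ hv, integrable_withDensity_iff_integrable_smul'
    (measurable_ofReal_gaussianKernel _ (by fun_prop)) (ae_of_all _ fun _ => ENNReal.ofReal_lt_top)]
  refine integrable_congr (ae_of_all _ fun x => ?_)
  simp only [smul_eq_mul]
  rw [ENNReal.toReal_ofReal (gaussianKernel_pos (by positivity) _).le]

lemma gaussianKernel_le_gaussianKernel {d : ℕ} {s : ℝ} (hs : 0 < s)
    {x y : EuclideanSpace ℝ (Fin d)} (h : ‖y‖ ≤ ‖x‖) :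
    gaussianKernel s x ≤ gaussianKernel s y := by
  unfold gaussianKernel
  gcongr

/-- Adding the integrand at `z` and at `-z` leaves a nonnegative function, because the density of
`N(η, 1)` is larger at whichever of the two points has a nonnegative inner product with `η`. -/
lemma integral_inner_mul_nonneg {d : ℕ} (η : EuclideanSpace ℝ (Fin d))
    {g : EuclideanSpace ℝ (Fin d) → ℝ} (hg : ∀ z, 0 ≤ g z) (hsymm : ∀ z, g (-z) = g z)
    (hint : Integrable (fun z => inner ℝ z η * g z) (normalLaw η 1)) :
    0 ≤ ∫ z, inner ℝ z η * g z ∂(normalLaw η 1) := by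
  rw [integrable_normalLaw_iff η one_ne_zero] at hint
  rw [integral_normalLaw_eq_integral_mul η one_ne_zero]
  set f : EuclideanSpace ℝ (Fin d) → ℝ :=
    fun z => gaussianKernel ((1 : ℝ≥0) : ℝ) (z - η) * (inner ℝ z η * g z) with hf
  have h2 : 0 ≤ ∫ z, (f z + f (-z)) := by
    refine integral_nonneg fun z => ?_
    have e : f z + f (-z) = (gaussianKernel ((1 : ℝ≥0) : ℝ) (z - η)
        - gaussianKernel ((1 : ℝ≥0) : ℝ) (z + η)) * inner ℝ z η * g z := by
      simp only [hf]
      rw [hsymm, inner_neg_left, ← gaussianKernel_neg _ (-z - η)]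
      rw [show -(-z - η) = z + η by abel]
      ring
    simp only [Pi.zero_apply]
    rw [e]
    refine mul_nonneg ?_ (hg z)
    have h3 := norm_add_sq_real z η
    have h4 := norm_sub_sq_real z η
    rcases le_total 0 (inner ℝ z η) with hi | hi
    · refine mul_nonneg (sub_nonneg.2 (gaussianKernel_le_gaussianKernel (by simp) ?_)) hi
      exact le_of_sq_le_sq (by linarith) (norm_nonneg _)
    · refine mul_nonneg_of_nonpos_of_nonpos
        (sub_nonpos.2 (gaussianKernel_le_gaussianKernel (by simp) ?_)) hi
      exact le_of_sq_le_sq (by linarith) (norm_nonneg _)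
  rw [integral_add hint hint.comp_neg, integral_neg_eq_self f] at h2
  linarith

lemma integral_comp_neg_normalLaw {d : ℕ} {v : ℝ≥0} (hv : v ≠ 0)
    (f : EuclideanSpace ℝ (Fin d) → ℝ) :
    ∫ x, f (-x) ∂(normalLaw (0 : EuclideanSpace ℝ (Fin d)) v) = ∫ x, f x ∂(normalLaw 0 v) := by
  rw [integral_normalLaw_eq_integral_mul _ hv, integral_normalLaw_eq_integral_mul _ hv,
    ← integral_neg_eq_self]
  refine integral_congr_ae (ae_of_all _ fun x => ?_)
  simp only [sub_zero, neg_neg, gaussianKernel_neg]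

/-- Stein's identity for a normal law with unit variance. -/
lemma integral_inner_sub_mul_eq_integral_fderiv {d : ℕ} (η v : EuclideanSpace ℝ (Fin d))
    {f : EuclideanSpace ℝ (Fin d) → ℝ} (hf : Differentiable ℝ f)
    (h0 : Integrable f (normalLaw η 1))
    (h1 : Integrable (fun z => fderiv ℝ f z v) (normalLaw η 1))
    (h2 : Integrable (fun z => inner ℝ (z - η) v * f z) (normalLaw η 1)) :
    ∫ z, inner ℝ (z - η) v * f z ∂(normalLaw η 1) = ∫ z, fderiv ℝ f z v ∂(normalLaw η 1) := by
  have hk : ∀ z : EuclideanSpace ℝ (Fin d),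
      HasFDerivAt (fun z => gaussianKernel ((1 : ℝ≥0) : ℝ) (z - η))
      (-(gaussianKernel ((1 : ℝ≥0) : ℝ) (z - η)) • innerSL ℝ (z - η)) z := by
    intro z
    have e1 : HasFDerivAt (fun z : EuclideanSpace ℝ (Fin d) => ‖z - η‖ ^ 2)
        (2 • (innerSL ℝ (z - η)).comp (ContinuousLinearMap.id ℝ _)) z :=
      ((hasFDerivAt_id z).sub_const η).norm_sq
    have e2 := ((e1.neg.mul_const ((2 : ℝ)⁻¹)).exp).const_mul
      ((√(2 * Real.pi * ((1 : ℝ≥0) : ℝ)))⁻¹ ^ d)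
    refine (e2.congr_fderiv ?_).congr_of_eventuallyEq (Filter.Eventually.of_forall fun y => ?_)
    · ext w
      simp [gaussianKernel, div_eq_mul_inv]
      ring
    · simp [gaussianKernel, div_eq_mul_inv]
  rw [integrable_normalLaw_iff η one_ne_zero] at h0 h1 h2
  rw [integral_normalLaw_eq_integral_mul η one_ne_zero,
    integral_normalLaw_eq_integral_mul η one_ne_zero]
  have e : ∀ z : EuclideanSpace ℝ (Fin d),
      fderiv ℝ (fun z => gaussianKernel ((1 : ℝ≥0) : ℝ) (z - η)) z v * f z
        = -(gaussianKernel ((1 : ℝ≥0) : ℝ) (z - η) * (inner ℝ (z - η) v * f z)) := by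
    intro z
    rw [(hk z).fderiv]
    simp [inner_sub_left]
    ring
  rw [integral_mul_fderiv_eq_neg_fderiv_mul_of_integrable (v := v) _ h1 h0
    (fun z _ => (hk z).differentiableAt) (fun z _ => hf z)]
  · simp_rw [e]
    rw [integral_neg, neg_neg]
  · simp_rw [e]
    exact h2.neg

/-! ### The mean radial derivative of the log marginal density -/

lemma inner_self_eq_sum_inner_mul {d : ℕ} (x z : EuclideanSpace ℝ (Fin d)) :
    inner ℝ x z = ∑ i, inner ℝ x (EuclideanSpace.single i (1 : ℝ)) * z i := by
  rw [PiLp.inner_apply]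
  refine Finset.sum_congr rfl fun i _ => ?_
  simp [EuclideanSpace.inner_single_right, mul_comm]

/-- Stein's identity for the vector field `z / (‖z‖² + κ)`, a smooth version of `z / ‖z‖²`. -/
lemma integral_inner_sub_self_div {d : ℕ} (η : EuclideanSpace ℝ (Fin d)) {κ : ℝ} (hκ : 0 < κ) :
    ∫ z, inner ℝ (z - η) z / (‖z‖ ^ 2 + κ) ∂(normalLaw η 1)
      = ∫ z, (d / (‖z‖ ^ 2 + κ) - 2 * ‖z‖ ^ 2 / (‖z‖ ^ 2 + κ) ^ 2) ∂(normalLaw η 1) := by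
  have hpos : ∀ z : EuclideanSpace ℝ (Fin d), 0 < ‖z‖ ^ 2 + κ := fun z => by positivity
  have hcoord : ∀ (z : EuclideanSpace ℝ (Fin d)) i, z i ^ 2 ≤ ‖z‖ ^ 2 := fun z i => by
    rw [← sq_abs, ← Real.norm_eq_abs]
    exact pow_le_pow_left₀ (norm_nonneg _) (PiLp.norm_apply_le z i) 2
  let f : Fin d → EuclideanSpace ℝ (Fin d) → ℝ := fun i z => z i / (‖z‖ ^ 2 + κ)
  have hderiv : ∀ i z, HasFDerivAt (f i)
      (((‖z‖ ^ 2 + κ) ^ 2)⁻¹ • ((‖z‖ ^ 2 + κ) • (EuclideanSpace.proj i : _ →L[ℝ] ℝ)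
        - z i • (2 • innerSL ℝ z))) z := by
    intro i z
    have e1 : HasFDerivAt (fun z : EuclideanSpace ℝ (Fin d) => ‖z‖ ^ 2 + κ)
        (2 • innerSL ℝ z) z :=
      (hasStrictFDerivAt_norm_sq z).hasFDerivAt.add_const κ
    have e2 : HasFDerivAt (fun z : EuclideanSpace ℝ (Fin d) => z i)
        (EuclideanSpace.proj i : _ →L[ℝ] ℝ) z :=
      (EuclideanSpace.proj i : EuclideanSpace ℝ (Fin d) →L[ℝ] ℝ).hasFDerivAt
    refine (e2.mul ((hasDerivAt_inv (hpos z).ne').comp_hasFDerivAt z e1)).congr_fderiv ?_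
    have := (hpos z).ne'
    ext w
    simp
    field_simp
    ring
  have hfd : ∀ i z, fderiv ℝ (f i) z (EuclideanSpace.single i 1)
      = 1 / (‖z‖ ^ 2 + κ) - 2 * z i ^ 2 / (‖z‖ ^ 2 + κ) ^ 2 := by
    intro i z
    rw [(hderiv i z).fderiv]
    have := (hpos z).ne'
    simp [EuclideanSpace.inner_single_right]
    field_simp
  have hinner : ∀ i (z : EuclideanSpace ℝ (Fin d)),
      inner ℝ (z - η) (EuclideanSpace.single i (1 : ℝ)) = z i - η i := fun i z => by
    simp [EuclideanSpace.inner_single_right]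
  have hb1 : ∀ i, Integrable (f i) (normalLaw η 1) := fun i => by
    refine integrable_normalLaw_of_abs_le η 1 (by fun_prop) (A := 1 / κ) (B := 1 / κ) fun z => ?_
    have h1 : |z i| ≤ 1 + ‖z‖ ^ 2 := by
      have := hcoord z i
      rw [← sq_abs] at this
      nlinarith [sq_nonneg (|z i| - 1)]
    rw [abs_div, abs_of_pos (hpos z), div_le_iff₀ (hpos z)]
    have h2 : (1 / κ + 1 / κ * ‖z‖ ^ 2) * (‖z‖ ^ 2 + κ)
        = (1 + ‖z‖ ^ 2) * (‖z‖ ^ 2 / κ) + (1 + ‖z‖ ^ 2) := by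
      field_simp
    have h3 : 0 ≤ (1 + ‖z‖ ^ 2) * (‖z‖ ^ 2 / κ) := by positivity
    linarith
  have hb2 : ∀ i, Integrable (fun z => fderiv ℝ (f i) z (EuclideanSpace.single i 1))
      (normalLaw η 1) := fun i => by
    simp_rw [hfd]
    refine integrable_normalLaw_of_abs_le η 1 (by fun_prop) (A := 1 / κ) (B := 2 / κ ^ 2)
      fun z => ?_
    refine (abs_sub _ _).trans (add_le_add ?_ ?_)
    · rw [abs_of_pos (by have := hpos z; positivity)]
      exact one_div_le_one_div_of_le hκ (by linarith [sq_nonneg ‖z‖])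
    · rw [abs_of_nonneg (by positivity), div_mul_eq_mul_div]
      have := hcoord z i
      have := sq_nonneg ‖z‖
      gcongr
      linarith
  have hb3 : ∀ i, Integrable
      (fun z => inner ℝ (z - η) (EuclideanSpace.single i (1 : ℝ)) * f i z)
      (normalLaw η 1) := fun i => by
    simp_rw [hinner]
    refine integrable_normalLaw_of_abs_le η 1 (by fun_prop) (A := η i ^ 2 / κ) (B := 2 / κ)
      fun z => ?_
    have h1 : |(z i - η i) * z i| ≤ η i ^ 2 + 2 * ‖z‖ ^ 2 := by
      have := hcoord z i
      rw [abs_le]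
      constructor <;> nlinarith [sq_nonneg (z i - η i), sq_nonneg (z i + η i)]
    have h2 : (z i - η i) * f i z = (z i - η i) * z i / (‖z‖ ^ 2 + κ) := by
      simp only [f]
      ring
    rw [h2, abs_div, abs_of_pos (hpos z)]
    calc _ ≤ (η i ^ 2 + 2 * ‖z‖ ^ 2) / κ := by
          refine div_le_div₀ (by positivity) h1 hκ ?_
          linarith [sq_nonneg ‖z‖]
      _ = _ := by ring
  have hS := fun i => integral_inner_sub_mul_eq_integral_fderiv η (EuclideanSpace.single i 1)
    (fun z => (hderiv i z).differentiableAt) (hb1 i) (hb2 i) (hb3 i)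
  calc _ = ∫ z, ∑ i, inner ℝ (z - η) (EuclideanSpace.single i (1 : ℝ)) * f i z
        ∂(normalLaw η 1) := by
        refine integral_congr_ae (ae_of_all _ fun z => ?_)
        simp only [f]
        rw [inner_self_eq_sum_inner_mul (z - η) z, Finset.sum_div]
        exact Finset.sum_congr rfl fun i _ => mul_div_assoc _ _ _
    _ = ∫ z, ∑ i, fderiv ℝ (f i) z (EuclideanSpace.single i 1) ∂(normalLaw η 1) := by
        rw [integral_finsetSum _ fun i _ => hb3 i, integral_finsetSum _ fun i _ => hb2 i]
        exact Finset.sum_congr rfl fun i _ => hS i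
    _ = _ := by
        refine integral_congr_ae (ae_of_all _ fun z => ?_)
        simp only [hfd]
        rw [Finset.sum_sub_distrib, ← Finset.sum_div, ← Finset.sum_div, ← Finset.mul_sum]
        simp [EuclideanSpace.norm_sq_eq]

/-- The mean of `⟨z, η⟩ / (‖z‖² + κ)` under `N(η, 1)` is at most `‖η‖² / (d - 2 + ‖η‖²)`. With `A`
the mean of `1 / (‖z‖² + κ)`, it is at most `1 - (d - 2) A` by Stein's identity, and at most
`‖η‖² A` because `1 / (‖z‖² + κ)` is negatively correlated with `⟨z - η, η⟩`. -/
lemma integral_inner_div_le {d : ℕ} (hd : 2 < d) (η : EuclideanSpace ℝ (Fin d)) {κ : ℝ}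
    (hκ : 0 < κ) :
    Integrable (fun z => inner ℝ z η / (‖z‖ ^ 2 + κ)) (normalLaw η 1) ∧
    ∫ z, inner ℝ z η / (‖z‖ ^ 2 + κ) ∂(normalLaw η 1) ≤ ‖η‖ ^ 2 / (d - 2 + ‖η‖ ^ 2) := by
  have hd' : (2 : ℝ) < d := by exact_mod_cast hd
  have hpos : ∀ z : EuclideanSpace ℝ (Fin d), 0 < ‖z‖ ^ 2 + κ := fun z => by positivity
  have hinner : ∀ z : EuclideanSpace ℝ (Fin d), |inner ℝ z η| ≤ ‖η‖ ^ 2 + ‖z‖ ^ 2 := fun z => by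
    have := abs_real_inner_le_norm z η
    nlinarith [sq_nonneg (‖z‖ - ‖η‖), sq_nonneg ‖z‖, sq_nonneg ‖η‖]
  have hAint : Integrable (fun z => 1 / (‖z‖ ^ 2 + κ)) (normalLaw η 1) := by
    refine integrable_normalLaw_of_abs_le η 1 (by fun_prop) (A := 1 / κ) (B := 0) fun z => ?_
    rw [abs_of_pos (by have := hpos z; positivity), zero_mul, add_zero]
    exact one_div_le_one_div_of_le hκ (by linarith [sq_nonneg ‖z‖])
  have hBint : Integrable (fun z => inner ℝ z η / (‖z‖ ^ 2 + κ)) (normalLaw η 1) := by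
    refine integrable_normalLaw_of_abs_le η 1 (by fun_prop) (A := ‖η‖ ^ 2 / κ) (B := 1 / κ)
      fun z => ?_
    rw [abs_div, abs_of_pos (hpos z)]
    calc _ ≤ (‖η‖ ^ 2 + ‖z‖ ^ 2) / κ := by
          refine div_le_div₀ (by positivity) (hinner z) hκ ?_
          linarith [sq_nonneg ‖z‖]
      _ = _ := by ring
  refine ⟨hBint, ?_⟩
  set A := ∫ z, 1 / (‖z‖ ^ 2 + κ) ∂(normalLaw η 1) with hA
  set B := ∫ z, inner ℝ z η / (‖z‖ ^ 2 + κ) ∂(normalLaw η 1) with hB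
  -- Stein's identity gives `B ≤ 1 - (d - 2) A`.
  have h1 : B ≤ 1 - (d - 2) * A := by
    have hWint : Integrable (fun z => ‖z‖ ^ 2 / (‖z‖ ^ 2 + κ)) (normalLaw η 1) := by
      refine integrable_normalLaw_of_abs_le η 1 (by fun_prop) (A := 1) (B := 0) fun z => ?_
      rw [abs_of_nonneg (by have := hpos z; positivity), zero_mul, add_zero,
        div_le_one (hpos z)]
      linarith
    have hS := integral_inner_sub_self_div η hκ
    have e1 : ∀ z : EuclideanSpace ℝ (Fin d), inner ℝ (z - η) z / (‖z‖ ^ 2 + κ)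
        = ‖z‖ ^ 2 / (‖z‖ ^ 2 + κ) - inner ℝ z η / (‖z‖ ^ 2 + κ) := fun z => by
      rw [inner_sub_left, real_inner_self_eq_norm_sq, real_inner_comm, sub_div]
    have hSint : Integrable
        (fun z => ((d : ℝ) / (‖z‖ ^ 2 + κ) - 2 * ‖z‖ ^ 2 / (‖z‖ ^ 2 + κ) ^ 2))
        (normalLaw η 1) := by
      refine (hAint.const_mul (d : ℝ)).congr (ae_of_all _ fun z => mul_one_div _ _) |>.sub ?_
      refine integrable_normalLaw_of_abs_le η 1 (by fun_prop) (A := 0) (B := 2 / κ ^ 2)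
        fun z => ?_
      rw [abs_of_nonneg (by positivity), zero_add, div_mul_eq_mul_div]
      have := sq_nonneg ‖z‖
      gcongr
      linarith
    simp_rw [e1] at hS
    rw [integral_sub hWint hBint] at hS
    have h2 : ∫ z, ‖z‖ ^ 2 / (‖z‖ ^ 2 + κ) ∂(normalLaw η 1)
        - ∫ z, ((d : ℝ) / (‖z‖ ^ 2 + κ) - 2 * ‖z‖ ^ 2 / (‖z‖ ^ 2 + κ) ^ 2) ∂(normalLaw η 1)
        ≤ ∫ z, (1 - (d - 2) * (1 / (‖z‖ ^ 2 + κ))) ∂(normalLaw η 1) := by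
      rw [← integral_sub hWint hSint]
      refine integral_mono (hWint.sub hSint)
        ((integrable_const _).sub (hAint.const_mul _)) fun z => ?_
      have hz := hpos z
      have e2 : 1 - ((d : ℝ) - 2) * (1 / (‖z‖ ^ 2 + κ))
          - (‖z‖ ^ 2 / (‖z‖ ^ 2 + κ)
            - ((d : ℝ) / (‖z‖ ^ 2 + κ) - 2 * ‖z‖ ^ 2 / (‖z‖ ^ 2 + κ) ^ 2))
          = κ / (‖z‖ ^ 2 + κ) + 2 * κ / (‖z‖ ^ 2 + κ) ^ 2 := by
        field_simp
        ring
      have e3 : 0 ≤ κ / (‖z‖ ^ 2 + κ) + 2 * κ / (‖z‖ ^ 2 + κ) ^ 2 := by positivity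
      simp only
      linarith
    rw [integral_sub (integrable_const _) (hAint.const_mul _), integral_const_mul] at h2
    simp only [integral_const, probReal_univ, one_smul] at h2
    linarith
  -- Reflecting the noise `z - η` shows that it pulls `1 / (‖z‖² + κ)` down along `η`.
  have h2 : B ≤ ‖η‖ ^ 2 * A := by
    have e1 : B - ‖η‖ ^ 2 * A = ∫ z, inner ℝ (z - η) η / (‖z‖ ^ 2 + κ) ∂(normalLaw η 1) := by
      rw [hA, hB, ← integral_const_mul, ← integral_sub hBint (hAint.const_mul _)]
      refine integral_congr_ae (ae_of_all _ fun z => ?_)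
      simp only
      rw [inner_sub_left, real_inner_self_eq_norm_sq]
      ring
    have hCint : Integrable (fun z => inner ℝ (z - η) η / (‖z‖ ^ 2 + κ)) (normalLaw η 1) := by
      refine (hBint.sub (hAint.const_mul (‖η‖ ^ 2))).congr (ae_of_all _ fun z => ?_)
      simp only [Pi.sub_apply]
      rw [inner_sub_left, real_inner_self_eq_norm_sq]
      ring
    let f : EuclideanSpace ℝ (Fin d) → ℝ := fun x => inner ℝ x η / (‖η + x‖ ^ 2 + κ)
    have e2 : ∫ z, inner ℝ (z - η) η / (‖z‖ ^ 2 + κ) ∂(normalLaw η 1)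
        = ∫ x, f x ∂(normalLaw 0 1) := by
      rw [integral_normalLaw_eq η 1 _ (by fun_prop)]
      simp [f]
    have hfint : Integrable f (normalLaw 0 1) := by
      rw [normalLaw_eq_map η 1] at hCint
      have := (integrable_map_measure
        (Measurable.aestronglyMeasurable (by fun_prop)) (by fun_prop)).1 hCint
      refine this.congr (ae_of_all _ fun x => ?_)
      simp [f]
    have hfint' : Integrable (fun x => f (-x)) (normalLaw 0 1) := by
      rw [integrable_normalLaw_iff 0 one_ne_zero] at hfint ⊢
      refine hfint.comp_neg.congr (ae_of_all _ fun x => ?_)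
      simp only [sub_zero, gaussianKernel_neg]
    have h3 : ∫ x, (f x + f (-x)) ∂(normalLaw 0 1) ≤ 0 := by
      refine integral_nonpos fun x => ?_
      simp only [Pi.zero_apply, f]
      rw [inner_neg_left, neg_div, ← sub_eq_add_neg, sub_nonpos, ← sub_eq_add_neg]
      have h4 := norm_add_sq_real η x
      have h5 := norm_sub_sq_real η x
      have h6 := hpos (η + x)
      have h7 := hpos (η - x)
      rw [div_le_div_iff₀ h6 h7]
      rw [real_inner_comm] at h4 h5
      nlinarith [sq_nonneg (inner ℝ x η)]
    rw [integral_add hfint hfint', integral_comp_neg_normalLaw one_ne_zero] at h3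
    linarith
  have h3 : 0 < (d : ℝ) - 2 + ‖η‖ ^ 2 := by
    have := sq_nonneg ‖η‖
    linarith
  rw [le_div_iff₀ h3]
  nlinarith [sq_nonneg ‖η‖]

/-- The bound `x * steinRate α x ≤ α` may be inserted under the mean, although `⟨z, η⟩` changes
sign, thanks to the symmetrization `integral_inner_mul_nonneg`. -/
lemma integral_inner_mul_steinRate_le {d : ℕ} (hd : 2 < d) (η : EuclideanSpace ℝ (Fin d)) :
    ∫ z, inner ℝ z η * steinRate ((d : ℝ) / 2 - 1) (‖z‖ ^ 2) ∂(normalLaw η 1)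
      ≤ ((d : ℝ) / 2 - 1) * (‖η‖ ^ 2 / (d - 2 + ‖η‖ ^ 2)) := by
  have hd' : (2 : ℝ) < d := by exact_mod_cast hd
  set α : ℝ := (d : ℝ) / 2 - 1 with hα
  have hα0 : 0 < α := by linarith
  have hint : Integrable (fun z => inner ℝ z η * steinRate α (‖z‖ ^ 2)) (normalLaw η 1) := by
    refine integrable_normalLaw_of_abs_le η 1 ?_ (A := ‖η‖ ^ 2) (B := 1) fun z => ?_
    · have := (continuous_steinRate hα0).measurable
      fun_prop
    · have h1 := abs_real_inner_le_norm z η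
      have h2 := steinRate_nonneg hα0 (‖z‖ ^ 2)
      have h3 := steinRate_le_half hα0 (‖z‖ ^ 2)
      rw [abs_mul, abs_of_nonneg h2]
      calc _ ≤ ‖z‖ * ‖η‖ * (1 / 2) := mul_le_mul h1 h3 h2 (by positivity)
        _ ≤ _ := by nlinarith [sq_nonneg (‖z‖ - ‖η‖), sq_nonneg ‖z‖, sq_nonneg ‖η‖]
  have hle1 : ‖η‖ ^ 2 / ((d : ℝ) - 2 + ‖η‖ ^ 2) ≤ 1 := by
    have := sq_nonneg ‖η‖
    rw [div_le_one (by linarith)]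
    linarith
  refine le_of_forall_pos_le_add fun κ hκ => ?_
  obtain ⟨hBint, hB⟩ := integral_inner_div_le hd η hκ
  have hpos : ∀ z : EuclideanSpace ℝ (Fin d), 0 < ‖z‖ ^ 2 + κ := fun z => by positivity
  have hBint' := hBint.const_mul (α + κ / 2)
  have e : ∀ z : EuclideanSpace ℝ (Fin d),
      inner ℝ z η * ((α + κ / 2) / (‖z‖ ^ 2 + κ) - steinRate α (‖z‖ ^ 2))
        = (α + κ / 2) * (inner ℝ z η / (‖z‖ ^ 2 + κ))
          - inner ℝ z η * steinRate α (‖z‖ ^ 2) := fun z => by ring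
  have h := integral_inner_mul_nonneg η
    (g := fun z => (α + κ / 2) / (‖z‖ ^ 2 + κ) - steinRate α (‖z‖ ^ 2))
    (fun z => by
      rw [sub_nonneg, le_div_iff₀ (hpos z)]
      have h1 := mul_steinRate_le hα0 (‖z‖ ^ 2)
      have h2 := steinRate_le_half hα0 (‖z‖ ^ 2)
      nlinarith)
    (fun z => by simp only [norm_neg])
    ((hBint'.sub hint).congr (ae_of_all _ fun z => (e z).symm))
  simp_rw [e] at h
  rw [integral_sub hBint' hint, integral_const_mul] at h
  have h4 := mul_le_mul_of_nonneg_left hB (by positivity : 0 ≤ α + κ / 2)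
  nlinarith

/-! ### Monotonicity in the signal strength and the risk bound -/

/-- The mean of `-log (steinProfile α ‖z‖²)` under `N(τ θ, 1)`, where `α = d / 2 - 1`. -/
def meanNegLogProfile {d : ℕ} (θ : EuclideanSpace ℝ (Fin d)) (τ : ℝ) : ℝ :=
  ∫ x, -Real.log (steinProfile ((d : ℝ) / 2 - 1) (‖τ • θ + x‖ ^ 2))
    ∂(normalLaw (0 : EuclideanSpace ℝ (Fin d)) 1)

lemma measurable_log_steinProfile {α : ℝ} (hα : 0 < α) :
    Measurable fun x => Real.log (steinProfile α x) :=
  Real.measurable_log.comp (continuous_steinProfile hα).measurable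

lemma integrable_log_steinProfile {d : ℕ} {α : ℝ} (hα : 0 < α)
    (η θ : EuclideanSpace ℝ (Fin d)) (v : ℝ≥0) :
    Integrable (fun x => Real.log (steinProfile α (‖η + x‖ ^ 2))) (normalLaw θ v) := by
  refine integrable_normalLaw_of_abs_le θ v ?_
    (A := |Real.log (steinProfile α 0)| + ‖η‖ ^ 2) (B := 1) fun x => ?_
  · exact (measurable_log_steinProfile hα).comp (by fun_prop)
  · refine (abs_log_steinProfile_le hα (by positivity)).trans ?_
    have h1 := norm_add_le η x
    nlinarith [sq_nonneg (‖η‖ - ‖x‖), norm_nonneg (η + x)]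

lemma hasDerivAt_meanNegLogProfile {d : ℕ} (hd : 2 < d) (θ : EuclideanSpace ℝ (Fin d)) (τ : ℝ) :
    HasDerivAt (meanNegLogProfile θ)
      (∫ z, 2 * (inner ℝ z θ * steinRate ((d : ℝ) / 2 - 1) (‖z‖ ^ 2)) ∂(normalLaw (τ • θ) 1))
      τ := by
  have hd' : (2 : ℝ) < d := by exact_mod_cast hd
  set α : ℝ := (d : ℝ) / 2 - 1 with hα
  have hα0 : 0 < α := by linarith
  have hrate := (continuous_steinRate hα0).measurable
  have key := hasDerivAt_integral_of_dominated_loc_of_deriv_le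
    (μ := normalLaw (0 : EuclideanSpace ℝ (Fin d)) 1) (s := Metric.ball τ 1) (x₀ := τ)
    (F := fun t x => -Real.log (steinProfile α (‖t • θ + x‖ ^ 2)))
    (F' := fun t x => 2 * (inner ℝ (t • θ + x) θ * steinRate α (‖t • θ + x‖ ^ 2)))
    (bound := fun x => (|τ| + 1) * ‖θ‖ ^ 2 + ‖θ‖ ^ 2 + ‖x‖ ^ 2)
    (Metric.ball_mem_nhds τ one_pos)
    (Filter.Eventually.of_forall fun t =>
      (integrable_log_steinProfile hα0 (t • θ) 0 1).neg.aestronglyMeasurable)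
    (integrable_log_steinProfile hα0 (τ • θ) 0 1).neg
    (Measurable.aestronglyMeasurable (by fun_prop))
    (ae_of_all _ fun x t ht => by
      have h1 := abs_real_inner_le_norm (t • θ + x) θ
      have h2 := steinRate_nonneg hα0 (‖t • θ + x‖ ^ 2)
      have h3 := steinRate_le_half hα0 (‖t • θ + x‖ ^ 2)
      have h4 : |t| ≤ |τ| + 1 := by
        have := Metric.mem_ball.1 ht
        rw [Real.dist_eq] at this
        have h5 := abs_sub_abs_le_abs_sub t τ
        linarith
      have h5 : ‖t • θ + x‖ ≤ (|τ| + 1) * ‖θ‖ + ‖x‖ := by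
        refine (norm_add_le _ _).trans ?_
        rw [norm_smul, Real.norm_eq_abs]
        gcongr
      rw [norm_mul, norm_mul, Real.norm_of_nonneg h2, Real.norm_eq_abs (inner ℝ _ _),
        Real.norm_of_nonneg zero_le_two]
      calc 2 * (|inner ℝ (t • θ + x) θ| * steinRate α (‖t • θ + x‖ ^ 2))
          ≤ 2 * (‖t • θ + x‖ * ‖θ‖ * (1 / 2)) := by gcongr
        _ = ‖t • θ + x‖ * ‖θ‖ := by ring
        _ ≤ ((|τ| + 1) * ‖θ‖ + ‖x‖) * ‖θ‖ := by gcongr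
        _ ≤ _ := by nlinarith [sq_nonneg (‖x‖ - ‖θ‖), sq_nonneg ‖x‖, sq_nonneg ‖θ‖])
    ((integrable_const _).add (integrable_norm_sq_normalLaw 0 1))
    (ae_of_all _ fun x t _ => by
      have e1 : HasDerivAt (fun t : ℝ => t • θ + x) θ t := by
        simpa using ((hasDerivAt_id t).smul_const θ).add_const x
      refine ((hasDerivAt_neg_log_steinProfile hα0 _).comp t e1.norm_sq).congr_deriv ?_
      ring)
  refine key.2.congr_deriv ?_
  symm
  rw [integral_normalLaw_eq _ _ _ (by fun_prop)]
  simp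

/-- The difference `meanNegLogProfile θ τ - (d / 2) log (d + τ² ‖θ‖²)` is nonincreasing in `τ`. -/
lemma meanNegLogProfile_sub_le {d : ℕ} (hd : 2 < d) (θ : EuclideanSpace ℝ (Fin d)) {τ₁ τ₂ : ℝ}
    (h1 : 0 < τ₁) (h12 : τ₁ ≤ τ₂) :
    meanNegLogProfile θ τ₂ - meanNegLogProfile θ τ₁
      ≤ (d : ℝ) / 2 * (Real.log (d + τ₂ ^ 2 * ‖θ‖ ^ 2) - Real.log (d + τ₁ ^ 2 * ‖θ‖ ^ 2)) := by
  have hd' : (2 : ℝ) < d := by exact_mod_cast hd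
  have hpos : ∀ τ : ℝ, 0 < (d : ℝ) + τ ^ 2 * ‖θ‖ ^ 2 := fun τ => by positivity
  have hder : ∀ τ : ℝ, HasDerivAt
      (fun τ => meanNegLogProfile θ τ - (d : ℝ) / 2 * Real.log (d + τ ^ 2 * ‖θ‖ ^ 2))
      ((∫ z, 2 * (inner ℝ z θ * steinRate ((d : ℝ) / 2 - 1) (‖z‖ ^ 2)) ∂(normalLaw (τ • θ) 1))
        - (d : ℝ) / 2 * (2 * τ * ‖θ‖ ^ 2 / (d + τ ^ 2 * ‖θ‖ ^ 2))) τ := by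
    intro τ
    have e1 : HasDerivAt (fun τ : ℝ => (d : ℝ) + τ ^ 2 * ‖θ‖ ^ 2) (2 * τ * ‖θ‖ ^ 2) τ := by
      simpa using (((hasDerivAt_id τ).pow 2).mul_const (‖θ‖ ^ 2)).const_add (d : ℝ)
    exact (hasDerivAt_meanNegLogProfile hd θ τ).sub ((e1.log (hpos τ).ne').const_mul _)
  have hanti := antitoneOn_of_deriv_nonpos (convex_Ioi (0 : ℝ))
    (fun τ _ => (hder τ).continuousAt.continuousWithinAt)
    (fun τ _ => (hder τ).differentiableAt.differentiableWithinAt)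
    (fun τ hτ => by
      rw [interior_Ioi] at hτ
      have hτ0 : 0 < τ := hτ
      rw [(hder τ).deriv, sub_nonpos]
      have hb := integral_inner_mul_steinRate_le hd (τ • θ)
      have e1 : ∀ z : EuclideanSpace ℝ (Fin d),
          inner ℝ z (τ • θ) * steinRate ((d : ℝ) / 2 - 1) (‖z‖ ^ 2)
            = τ / 2 * (2 * (inner ℝ z θ * steinRate ((d : ℝ) / 2 - 1) (‖z‖ ^ 2))) := fun z => by
        rw [real_inner_smul_right]
        ring
      simp_rw [e1] at hb
      rw [integral_const_mul, norm_smul, mul_pow, Real.norm_eq_abs, sq_abs] at hb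
      set I := ∫ z, 2 * (inner ℝ z θ * steinRate ((d : ℝ) / 2 - 1) (‖z‖ ^ 2))
        ∂(normalLaw (τ • θ) 1)
      set l := τ ^ 2 * ‖θ‖ ^ 2 with hl
      have hl0 : 0 ≤ l := by positivity
      -- `x ↦ x / (x + l)` is nondecreasing, so `d - 2` may be replaced by `d`.
      have h3 : ((d : ℝ) / 2 - 1) * (l / (d - 2 + l)) ≤ (d : ℝ) / 2 * (l / (d + l)) := by
        have h4 : 0 < (d : ℝ) - 2 + l := by linarith
        have h5 : 0 < (d : ℝ) + l := by linarith
        rw [mul_div_assoc', mul_div_assoc', div_le_div_iff₀ h4 h5]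
        nlinarith [mul_nonneg hl0 hl0]
      have h6 : τ / 2 * I ≤ τ / 2 * ((d : ℝ) / 2 * (2 * τ * ‖θ‖ ^ 2 / (d + l))) := by
        refine (hb.trans h3).trans_eq ?_
        rw [hl]
        ring
      exact le_of_mul_le_mul_left h6 (by positivity))
  have := hanti h1 (h1.trans_le h12) h12
  simp only at this
  linarith

lemma integral_log_steinProfile {d : ℕ} (hd : 2 < d) {s : ℝ≥0} (hs : s ≠ 0)
    (θ : EuclideanSpace ℝ (Fin d)) :
    ∫ z, Real.log (steinProfile ((d : ℝ) / 2 - 1) (‖z‖ ^ 2 / s)) ∂(normalLaw θ s)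
      = -meanNegLogProfile θ (√(s : ℝ))⁻¹ := by
  have hd' : (2 : ℝ) < d := by exact_mod_cast hd
  have hs' : (0 : ℝ) < s := by positivity
  have hm : Measurable fun z : EuclideanSpace ℝ (Fin d) =>
      Real.log (steinProfile ((d : ℝ) / 2 - 1) (‖z‖ ^ 2 / s)) :=
    (measurable_log_steinProfile (by linarith)).comp (by fun_prop)
  rw [integral_normalLaw_eq θ s _ hm, meanNegLogProfile, integral_neg, neg_neg]
  refine integral_congr_ae (ae_of_all _ fun x => ?_)
  simp only
  congr 2
  have h1 : (√(s : ℝ))⁻¹ • θ + x = (√(s : ℝ))⁻¹ • (θ + √(s : ℝ) • x) := by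
    rw [smul_add, smul_smul, inv_mul_cancel₀ (by positivity), one_smul]
  rw [h1, norm_smul, mul_pow, norm_inv, Real.norm_of_nonneg (by positivity), inv_pow,
    Real.sq_sqrt hs'.le]
  ring

/-- The risk of the predictive distribution of Stein's prior, in terms of `meanNegLogProfile`. -/
lemma klRisk_steinPrior {d : ℕ} (hd : 2 < d) {v w : ℝ≥0} (hv : v ≠ 0) (hw : w ≠ 0)
    (θ : EuclideanSpace ℝ (Fin d)) :
    klRisk v w θ (bayesPredictive (steinPrior d) v w)
      = ENNReal.ofReal (Real.log (v / (v * w / (v + w)))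
          + (meanNegLogProfile θ (√((v : ℝ) * w / (v + w)))⁻¹
            - meanNegLogProfile θ (√(v : ℝ))⁻¹)) := by
  have hd' : (2 : ℝ) < d := by exact_mod_cast hd
  have hv' : (0 : ℝ) < v := by positivity
  have hw' : (0 : ℝ) < w := by positivity
  have hu0 : v * w / (v + w) ≠ 0 := by positivity
  set α : ℝ := (d : ℝ) / 2 - 1 with hα
  have hα0 : 0 < α := by linarith
  have hΓ := Real.Gamma_pos_of_pos hα0
  have h2α : (0 : ℝ) < 2 ^ α := by positivity
  set c : ℝ := Real.log (2 ^ α * Real.Gamma α)⁻¹ with hc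
  let l : ℝ≥0 → EuclideanSpace ℝ (Fin d) → ℝ :=
    fun s z => c - α * Real.log s + Real.log (steinProfile α (‖z‖ ^ 2 / s))
  have hM : ∀ {s : ℝ≥0}, s ≠ 0 → ∀ z, marginalDensity (steinPrior d) s z
      = ENNReal.ofReal (Real.exp (l s z)) := by
    intro s hs z
    have hs' : (0 : ℝ) < s := by positivity
    have hsα : 0 < (s : ℝ) ^ (-α) := by positivity
    rw [marginalDensity_steinPrior hd hs]
    congr 1
    rw [← Real.exp_log (mul_pos (inv_pos.2 (mul_pos h2α hΓ))
      (mul_pos hsα (steinProfile_pos hα0 (‖z‖ ^ 2 / s)))),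
      Real.log_mul (by positivity) (mul_pos hsα (steinProfile_pos hα0 _)).ne',
      Real.log_mul hsα.ne' (steinProfile_pos hα0 _).ne', Real.log_rpow hs']
    congr 1
    simp only [l, hc]
    ring
  have hmeas0 : ∀ s : ℝ≥0, Measurable fun z : EuclideanSpace ℝ (Fin d) =>
      Real.log (steinProfile α (‖z‖ ^ 2 / s)) := fun s =>
    (measurable_log_steinProfile hα0).comp (by fun_prop)
  have hmeas : ∀ s, Measurable (l s) := fun s => (hmeas0 s).const_add _
  have hb0 : ∀ (s : ℝ≥0) (z : EuclideanSpace ℝ (Fin d)),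
      |Real.log (steinProfile α (‖z‖ ^ 2 / s))|
        ≤ |Real.log (steinProfile α 0)| + 1 / (2 * (s : ℝ)) * ‖z‖ ^ 2 := fun s z => by
    refine (abs_log_steinProfile_le hα0 (by positivity)).trans_eq ?_
    ring
  have hb : ∀ (s : ℝ≥0) (z : EuclideanSpace ℝ (Fin d)), |l s z|
      ≤ (|c - α * Real.log s| + |Real.log (steinProfile α 0)|)
        + 1 / (2 * (s : ℝ)) * ‖z‖ ^ 2 := fun s z => by
    refine (abs_add_le _ _).trans ?_
    linarith [hb0 s z]
  have hI : ∀ {s : ℝ≥0}, s ≠ 0 → ∫ z, l s z ∂(normalLaw θ s)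
      = c - α * Real.log s - meanNegLogProfile θ (√(s : ℝ))⁻¹ := by
    intro s hs
    simp only [l]
    rw [integral_add (integrable_const _)
      (integrable_normalLaw_of_abs_le θ s (hmeas0 s) (hb0 s)), integral_log_steinProfile hd hs]
    simp
    ring
  have : SFinite (steinPrior d) := by
    unfold steinPrior
    infer_instance
  rw [klRisk_bayesPredictive (steinPrior d) hv hw (hmeas _) (hmeas _) (hM hv) (hM hu0) (hb _)
    (hb _) θ, hI hv, hI hu0]
  push_cast
  congr 1
  rw [Real.log_div hv'.ne' (by positivity), hα]
  ring

theorem klRisk_steinPrior_le {d : ℕ} (hd : 2 < d) {v w : ℝ≥0} (hv : v ≠ 0) (hw : w ≠ 0)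
    (θ : EuclideanSpace ℝ (Fin d)) :
    klRisk v w θ (bayesPredictive (steinPrior d) v w)
      ≤ ENNReal.ofReal (Real.log (v / (v * w / (v + w)))
          + (d : ℝ) / 2 * Real.log ((1 + ‖θ‖ ^ 2 / d / ((v : ℝ) * w / (v + w)))
            / (1 + ‖θ‖ ^ 2 / d / v))) := by
  have hv' : (0 : ℝ) < v := by positivity
  have hw' : (0 : ℝ) < w := by positivity
  have hd' : (0 : ℝ) < d := by
    have : (2 : ℝ) < d := by exact_mod_cast hd
    linarith
  rw [klRisk_steinPrior hd hv hw]
  set u : ℝ := (v : ℝ) * w / (v + w) with hu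
  have hu' : 0 < u := by positivity
  have huv : u ≤ v := by
    rw [hu, div_le_iff₀ (by positivity)]
    nlinarith
  have h := meanNegLogProfile_sub_le hd θ (τ₁ := (√(v : ℝ))⁻¹) (τ₂ := (√u)⁻¹) (by positivity)
    (inv_anti₀ (by positivity) (Real.sqrt_le_sqrt huv))
  rw [inv_pow, inv_pow, Real.sq_sqrt hu'.le, Real.sq_sqrt hv'.le,
    ← Real.log_div (by positivity) (by positivity)] at h
  have e : (1 + ‖θ‖ ^ 2 / d / u) / (1 + ‖θ‖ ^ 2 / d / v)
      = (d + u⁻¹ * ‖θ‖ ^ 2) / (d + (v : ℝ)⁻¹ * ‖θ‖ ^ 2) := by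
    field_simp
  rw [e]
  exact ENNReal.ofReal_le_ofReal (by linarith)

end

end SteinPrediction

theorem mainTheorem3 (d : ℕ) (hd : 2 < d) (ε δ : ℝ) (hε : 0 < ε) (hδ : 0 < δ)
    (θ : EuclideanSpace ℝ (Fin d)) :
    SteinPrediction.klRisk (SteinPrediction.noiseVar ε) (SteinPrediction.noiseVar δ) θ
        (SteinPrediction.bayesPredictive (SteinPrediction.steinPrior d)
          (SteinPrediction.noiseVar ε) (SteinPrediction.noiseVar δ))
      ≤ ENNReal.ofReal
          (Real.log (SteinPrediction.vSq ε / SteinPrediction.vSqJoint ε δ)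
            + (d : ℝ) / 2 *
              Real.log ((1 + (‖θ‖ ^ 2 / (d : ℝ)) / SteinPrediction.vSqJoint ε δ)
                / (1 + (‖θ‖ ^ 2 / (d : ℝ)) / SteinPrediction.vSq ε)))
    ∧ IsLeast
        (Set.range fun t : ℝ≥0 =>
          SteinPrediction.klRisk (SteinPrediction.noiseVar ε) (SteinPrediction.noiseVar δ) θ
            (SteinPrediction.bayesPredictive (SteinPrediction.gaussianPrior d t)
              (SteinPrediction.noiseVar ε) (SteinPrediction.noiseVar δ)))
        (ENNReal.ofReal
          ((d : ℝ) / 2 *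
            Real.log ((1 + (‖θ‖ ^ 2 / (d : ℝ)) / SteinPrediction.vSqJoint ε δ)
              / (1 + (‖θ‖ ^ 2 / (d : ℝ)) / SteinPrediction.vSq ε)))) := by
  have hcoe : ∀ x : ℝ, ((SteinPrediction.noiseVar x : ℝ≥0) : ℝ) = x ^ 2 := fun _ => rfl
  have hne : ∀ x : ℝ, 0 < x → SteinPrediction.noiseVar x ≠ 0 := fun x hx h => by
    have := hcoe x
    rw [h, NNReal.coe_zero] at this
    exact (pow_pos hx 2).ne this
  have hjoint : SteinPrediction.vSqJoint ε δ = ε ^ 2 * δ ^ 2 / (ε ^ 2 + δ ^ 2) := by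
    unfold SteinPrediction.vSqJoint
    field_simp
    ring
  have h1 := SteinPrediction.klRisk_steinPrior_le hd (hne ε hε) (hne δ hδ) θ
  have h2 := SteinPrediction.isLeast_klRisk_gaussianPrior (by omega) (hne ε hε) (hne δ hδ) θ
  rw [hcoe, hcoe] at h1 h2
  rw [hjoint, SteinPrediction.vSq]
  exact ⟨h1, h2⟩
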